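/- Let $\Omega=[0,2\pi]^2$ with periodic boundary conditions. Let $H$ be the space of real, mean-free, (distributionally) divergence-free fields in $L^2(\Omega)^2$, with norm $|\cdot|$ the $L^2$ norm, and let $V=\{u\in H:\nabla u\in L^2\}$ with norm $\|u\|^2=\sum_{j=1,2}|\partial_ju|^2$. Let $\mathbb P$ be the orthogonal (Leray) projection of $L^2(\Omega)^2$ onto $H$, $A=-\mathbb P\Delta$ the Stokes operator with domain $D(A)$, $B(u,v)=\mathbb P((u\cdot\nabla)v)$, and for $K>0$ let $P_K$ be the projection onto the Fourier wavenumbers $|k|\le K$. There exist absolute constants $C_0,C_1>0$ such that the following holds for all $\nu>0$, $K>0$, all $\theta_1,\theta_2\ge0$ with $\theta_1+\theta_2=1$, and all $g_1,g_2\in L^\infty(0,\infty;H)$ with $|g_1(t)-g_2(t)|\to0$ as $t\to\infty$. Put $$\mathfrak g_j=\frac{\sup_{t\ge0}|g_j(t)|}{\nu^2},\qquad \mathfrak g=(\mathfrak g_1^2+\mathfrak g_2^2)^{1/2}$$ (the supremum and the limit $|g_1(t)-g_2(t)|\to0$ being taken modulo null sets of times). Let $v=(v_1,v_2)$ be a global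 solution of the mutual direct-replacement intertwinement $$\partial_tv_1+\nu Av_1+B(v_1,v_1)=g_1+\theta_1P_KB(v_1,v_1)-\theta_1P_KB(v_2,v_2),$$ $$\partial_tv_2+\nu Av_2+B(v_2,v_2)=g_2-\theta_2P_KB(v_1,v_1)+\theta_2P_KB(v_2,v_2),$$ with initial data in $V\times V$, that is, $v\in\big(C([0,T];V)\cap L^2(0,T;D(A))\big)^2$ for all $T>0$ and $v$ satisfies the system, as an equation in $H$, in time-integrated form. If $K\ge C_0\,(\ln(e+K))^{1/2}\,\mathfrak g$, then $$\limsup_{t\to\infty}\|v(t)\|\le C_1\nu\,\mathfrak g,\qquad\text{where }\|v\|^2=\|v_1\|^2+\|v_2\|^2 .$$ -/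

import Mathlib

open MeasureTheory Filter Topology

noncomputable section

namespace NSE

instance instFactTwoPiPos : Fact (0 < 2 * Real.pi) := ⟨Real.two_pi_pos⟩

/-- The doubly periodic domain `[0, 2π]²`, with its Lebesgue measure `volume` (of total mass
`(2π)²`). -/
abbrev Torus : Type := Fin 2 → AddCircle (2 * Real.pi)

/-- Vectors of `ℝ²` with the Euclidean norm. -/
abbrev Vec : Type := EuclideanSpace ℝ (Fin 2)

/-- Square-integrable real vector fields on the torus. -/
abbrev L2 : Type := Lp Vec 2 (volume : Measure Torus)

/-- The exponential `exp (i k · x)` on the torus. -/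
def expMode (k : Fin 2 → ℤ) (x : Torus) : ℂ := ∏ i, fourier (k i) (x i)

/-- The `k`-th Fourier coefficient of the `j`-th component of `u`:
`(2π)⁻² ∫ exp (- i k · x) u_j(x) dx`. -/
def fourierCoef (u : L2) (k : Fin 2 → ℤ) (j : Fin 2) : ℂ :=
  (((2 * Real.pi) ^ 2)⁻¹ : ℂ) * ∫ x : Torus, expMode (-k) x * ((u x j : ℝ) : ℂ)

theorem norm_expMode (k : Fin 2 → ℤ) (x : Torus) : ‖expMode k x‖ = 1 := by
  simp only [expMode, norm_prod, fourier_apply, Circle.norm_coe, Finset.prod_const_one]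

theorem continuous_expMode (k : Fin 2 → ℤ) : Continuous (expMode k) := by
  unfold expMode
  fun_prop

theorem integrable_coord (u : L2) (j : Fin 2) :
    Integrable (fun x : Torus => ((u x j : ℝ) : ℂ)) := by
  have h1 : Integrable (fun x : Torus => u x) := (Lp.memLp u).integrable (by norm_num)
  have h2 : Integrable (fun x : Torus => u x j) :=
    (EuclideanSpace.proj (𝕜 := ℝ) j).integrable_comp h1
  exact h2.ofReal

theorem integrable_expMode_mul (u : L2) (k : Fin 2 → ℤ) (j : Fin 2) :
    Integrable (fun x : Torus => expMode k x * ((u x j : ℝ) : ℂ)) :=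
  (integrable_coord u j).bdd_mul (c := 1) (continuous_expMode k).aestronglyMeasurable
    (Eventually.of_forall fun x => (norm_expMode k x).le)

theorem fourierCoef_add (u v : L2) (k : Fin 2 → ℤ) (j : Fin 2) :
    fourierCoef (u + v) k j = fourierCoef u k j + fourierCoef v k j := by
  unfold fourierCoef
  rw [← mul_add, ← integral_add (integrable_expMode_mul u _ j) (integrable_expMode_mul v _ j)]
  congr 1
  refine integral_congr_ae ?_
  filter_upwards [Lp.coeFn_add u v] with x hx
  rw [hx]
  simp [mul_add]

theorem fourierCoef_smul (c : ℝ) (u : L2) (k : Fin 2 → ℤ) (j : Fin 2) :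
    fourierCoef (c • u) k j = (c : ℂ) * fourierCoef u k j := by
  unfold fourierCoef
  rw [mul_left_comm, ← integral_const_mul (c : ℂ)]
  congr 1
  refine integral_congr_ae ?_
  filter_upwards [Lp.coeFn_smul c u] with x hx
  have hc : (c • (u : Torus → Vec)) x j = c * u x j := rfl
  rw [hx, hc, Complex.ofReal_mul, mul_left_comm]

theorem fourierCoef_zero (k : Fin 2 → ℤ) (j : Fin 2) : fourierCoef 0 k j = 0 := by
  simpa using fourierCoef_smul 0 0 k j

theorem norm_fourierCoef_le (u : L2) (k : Fin 2 → ℤ) (j : Fin 2) :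
    ‖fourierCoef u k j‖ ≤
      ((2 * Real.pi) ^ 2)⁻¹ * ((volume : Measure Torus).real Set.univ ^ (1 / 2 : ℝ) * ‖u‖) := by
  have h0 : ‖(((2 * Real.pi) ^ 2)⁻¹ : ℂ)‖ = ((2 * Real.pi) ^ 2)⁻¹ := by
    simp [abs_of_pos Real.pi_pos]
  have h2 : ∫ x : Torus, ‖u x‖ ≤ (volume : Measure Torus).real Set.univ ^ (1 / 2 : ℝ) * ‖u‖ := by
    have hle := eLpNorm_le_eLpNorm_mul_rpow_measure_univ (p := 1) (q := 2)
      (μ := (volume : Measure Torus)) (by norm_num) (Lp.aestronglyMeasurable u)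
    rw [integral_norm_eq_lintegral_enorm (Lp.aestronglyMeasurable u), ← eLpNorm_one_eq_lintegral_enorm,
      Lp.norm_def, Measure.real, ENNReal.toReal_rpow, ← ENNReal.toReal_mul]
    refine ENNReal.toReal_mono (ENNReal.mul_ne_top ?_ (Lp.eLpNorm_ne_top u)) ?_
    · exact ENNReal.rpow_ne_top_of_nonneg (by norm_num) (measure_ne_top _ _)
    · refine hle.trans (le_of_eq ?_)
      norm_num [mul_comm]
  unfold fourierCoef
  rw [norm_mul, h0]
  refine mul_le_mul_of_nonneg_left (le_trans ?_ h2) (by positivity)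
  refine (norm_integral_le_integral_norm _).trans ?_
  refine integral_mono (integrable_expMode_mul u _ j).norm
    ((Lp.memLp u).integrable (by norm_num)).norm fun x => ?_
  simpa [norm_expMode] using PiLp.norm_apply_le (u x) j

theorem continuous_fourierCoef (k : Fin 2 → ℤ) (j : Fin 2) :
    Continuous fun u : L2 => fourierCoef u k j := by
  let f : L2 →ₗ[ℝ] ℂ :=
    { toFun := fun u => fourierCoef u k j
      map_add' := fun u v => fourierCoef_add u v k j
      map_smul' := fun c u => by simp [fourierCoef_smul] }
  exact (f.mkContinuous
    (((2 * Real.pi) ^ 2)⁻¹ * (volume : Measure Torus).real Set.univ ^ (1 / 2 : ℝ))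
    fun u => by simpa [f, mul_assoc] using norm_fourierCoef_le u k j).continuous

/-- The space `H` of square-integrable vector fields on the torus which are mean-free
(the coefficient at `k = 0` vanishes) and divergence-free in the sense of periodic distributions
(`i k · û_k = 0` for all `k`). Its norm is the `L²` norm `|·|`. -/
def H : Submodule ℝ L2 where
  carrier := {u | (∀ j, fourierCoef u 0 j = 0) ∧
    ∀ k : Fin 2 → ℤ, ∑ j, (k j : ℂ) * fourierCoef u k j = 0}
  zero_mem' := by simp [fourierCoef_zero]
  add_mem' := by
    rintro u v ⟨hu, hu'⟩ ⟨hv, hv'⟩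
    refine ⟨fun j => by simp [fourierCoef_add, hu j, hv j], fun k => ?_⟩
    simp only [fourierCoef_add, mul_add, Finset.sum_add_distrib, hu' k, hv' k, add_zero]
  smul_mem' := by
    rintro c u ⟨hu, hu'⟩
    refine ⟨fun j => by simp [fourierCoef_smul, hu j], fun k => ?_⟩
    simp only [fourierCoef_smul, mul_left_comm _ (c : ℂ), ← Finset.mul_sum, hu' k, mul_zero]

theorem isClosed_H : IsClosed (H : Set L2) := by
  have h : (H : Set L2) = (⋂ j, {u | fourierCoef u 0 j = 0}) ∩
      ⋂ k : Fin 2 → ℤ, {u | ∑ j, (k j : ℂ) * fourierCoef u k j = 0} := by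
    ext u
    simp [H]
  rw [h]
  refine IsClosed.inter (isClosed_iInter fun j => ?_) (isClosed_iInter fun k => ?_)
  · exact isClosed_eq (continuous_fourierCoef 0 j) continuous_const
  · exact isClosed_eq (continuous_finsetSum _ fun j _ =>
      continuous_const.mul (continuous_fourierCoef k j)) continuous_const

instance instCompleteSpaceH : CompleteSpace H := isClosed_H.completeSpace_coe

/-- The Leray projection: the orthogonal projection of `L²` onto `H`. -/
def leray (f : L2) : H := H.orthogonalProjectionOnto f

/-- `w` is the field with Fourier coefficients `ŵ_k = m(k) û_k`. -/
def IsMultiplier (m : (Fin 2 → ℤ) → ℂ) (u w : H) : Prop :=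
  ∀ (k : Fin 2 → ℤ) (j : Fin 2), fourierCoef w k j = m k * fourierCoef u k j

open Classical in
/-- The Fourier multiplier with symbol `m`; it has the value `0` outside its domain
`{u | ∃ w ∈ H, ŵ = m û}`. -/
def multiplier (m : (Fin 2 → ℤ) → ℂ) (u : H) : H :=
  if h : ∃ w, IsMultiplier m u w then h.choose else 0

/-- The squared Euclidean length `|k|²` of a wavenumber. -/
def sqLen (k : Fin 2 → ℤ) : ℝ := ∑ i, (k i : ℝ) ^ 2

/-- The symbol `i k_j` of the partial derivative `∂_j`. -/
def derivSymbol (j : Fin 2) (k : Fin 2 → ℤ) : ℂ := Complex.I * (k j : ℂ)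

/-- The symbol `|k|²` of the Stokes operator. -/
def stokesSymbol (k : Fin 2 → ℤ) : ℂ := (sqLen k : ℂ)

/-- The symbol of the projection onto the wavenumbers `|k| ≤ K`. -/
def projSymbol (K : ℝ) (k : Fin 2 → ℤ) : ℂ := if √(sqLen k) ≤ K then 1 else 0

/-- The weak partial derivative `∂_j u`. -/
def partialDeriv (j : Fin 2) (u : H) : H := multiplier (derivSymbol j) u

/-- The Stokes operator `A = -ℙΔ`. -/
def stokes (u : H) : H := multiplier stokesSymbol u

/-- The projection `P_K` onto the wavenumbers `|k| ≤ K`. -/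
def proj (K : ℝ) (u : H) : H := multiplier (projSymbol K) u

/-- The space `V`: the fields of `H` whose weak first derivatives are square-integrable. -/
def V : Set H := {u | ∀ j, ∃ w, IsMultiplier (derivSymbol j) u w}

/-- The domain `D(A)` of the Stokes operator. -/
def domStokes : Set H := {u | ∃ w, IsMultiplier stokesSymbol u w}

/-- The norm of `V`: `‖u‖² = ∑_j ∫ |∂_j u|² dx`. -/
def normV (u : H) : ℝ := √(∑ j, ‖partialDeriv j u‖ ^ 2)

/-- The pointwise expression `(u · ∇) v = ∑_j u_j ∂_j v`. -/
def advect (u v : H) (x : Torus) : Vec :=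
  ∑ j, ((u : L2) x j) • ((partialDeriv j v : H) : L2) x

open Classical in
/-- The bilinear operator `B(u, v) = ℙ((u · ∇) v)`, defined as an element of `H` whenever
`(u · ∇) v` is square-integrable (in particular for `u ∈ D(A)`, `v ∈ V`). -/
def B (u v : H) : H :=
  if h : MemLp (advect u v) 2 (volume : Measure Torus) then leray (h.toLp _) else 0

/-- The right-hand side of `dv_i/dt = g_i - ν A v_i - B(v_i, v_i) + ∑_j m_ij F(v_j)`. -/
def intertwinedRHS (ν : ℝ) (F : H → H) (M : Matrix (Fin 2) (Fin 2) ℝ) (g v : Fin 2 → ℝ → H)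
    (i : Fin 2) (t : ℝ) : H :=
  g i t - ν • stokes (v i t) - B (v i t) (v i t) + ∑ j, M i j • F (v j t)

/-- `v = (v_1, v_2)` is a global solution of the intertwinement `(v, F, M)` with viscosity `ν` and
forces `g = (g_1, g_2)`, with initial data in `V × V`: for all `T > 0`, it belongs to
`(C([0,T]; V) ∩ L²(0,T; D(A)))²`, and it satisfies the system. The system is an equation between
functions of time with values in `H`, and is written in its time-integrated form. -/
structure IsGlobalSolution (ν : ℝ) (F : H → H) (M : Matrix (Fin 2) (Fin 2) ℝ)
    (g v : Fin 2 → ℝ → H) : Prop where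
  mem_V : ∀ i, ∀ t, 0 ≤ t → v i t ∈ V
  continuous_V : ∀ i, ∀ t, 0 ≤ t →
    Tendsto (fun s => normV (v i s - v i t)) (𝓝[Set.Ici 0] t) (𝓝 0)
  mem_domStokes : ∀ i, ∀ᵐ t ∂volume.restrict (Set.Ioi (0 : ℝ)), v i t ∈ domStokes
  memLp_stokes : ∀ i, ∀ T, 0 < T →
    MemLp (fun t => stokes (v i t)) 2 (volume.restrict (Set.Ioo 0 T))
  integrable_rhs : ∀ i, ∀ T, 0 < T →
    IntervalIntegrable (intertwinedRHS ν F M g v i) volume 0 T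
  equation : ∀ i, ∀ t, 0 ≤ t →
    v i t = v i 0 + ∫ s in (0 : ℝ)..t, intertwinedRHS ν F M g v i s

/-- The intertwining function `F(u) = P_K B(u, u)` of the direct-replacement intertwinement. -/
def directReplacement (K : ℝ) (u : H) : H := proj K (B u u)

/-- The class of matrices of mutual direct-replacement intertwinements. -/
def mutualMatrices : Set (Matrix (Fin 2) (Fin 2) ℝ) :=
  {M | ∃ θ₁ θ₂ : ℝ, θ₁ + θ₂ = 1 ∧ 0 ≤ θ₁ ∧ 0 ≤ θ₂ ∧ M = !![θ₁, -θ₁; -θ₂, θ₂]}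

/-- `f ∈ L^∞(0, ∞; H)`. -/
def IsBoundedForce (f : ℝ → H) : Prop := MemLp f ⊤ (volume.restrict (Set.Ioi (0 : ℝ)))

/-- `|g_1(t) - g_2(t)| → 0` as `t → ∞`. As the `g_j` are classes of functions modulo null sets,
so is the limit. -/
def IsSynchronousPair (g₁ g₂ : ℝ → H) : Prop :=
  Tendsto (fun t => ‖g₁ t - g₂ t‖) (atTop ⊓ ae volume) (𝓝 0)

/-- `𝔤_j = sup_{t ≥ 0} |g_j(t)| / ν²`, with the supremum of an element of `L^∞(0, ∞; H)`. -/
def grashof₁ (ν : ℝ) (f : ℝ → H) : ℝ :=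
  (eLpNorm f ⊤ (volume.restrict (Set.Ioi (0 : ℝ)))).toReal / ν ^ 2

/-- `𝔤 = (𝔤_1² + 𝔤_2²)^{1/2}`. -/
def grashof (ν : ℝ) (g : Fin 2 → ℝ → H) : ℝ := √(∑ j, grashof₁ ν (g j) ^ 2)

/-- The norm of `V × V`: `‖(v_1, v_2)‖² = ‖v_1‖² + ‖v_2‖²`. -/
def normVPair (v : Fin 2 → H) : ℝ := √(∑ i, normV (v i) ^ 2)

end NSE

end

/-! Write `w = v₁ - v₂`. Since `θ₁ + θ₂ = 1`, the nonlinearity drops out of the low modes of `w`: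
`P_K w` solves a forced heat equation with force `P_K (g₁ - g₂)`, so `z = |P_K w|²` tends to zero
(`low_modes_deriv_le`).

Weight the two enstrophies crosswise, `X = θ₂ ‖v₁‖² + θ₁ ‖v₂‖²`. In two dimensions `(B(u,u), Au) =
0` (`inner_B_stokes_self`), so only the coupling survives from the nonlinear terms, and with these
weights it is `θ₁ θ₂ (B(v₁,v₁) - B(v₂,v₂), P_K A w)`. This involves only low modes of `w`, hence is
at most a multiple of `√z X`. The multiple depends on `K`, which is harmless because `z` vanishes in
the limit. Thus `X` obeys, up to a vanishing perturbation, the usual enstrophy inequality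
(`enstrophy_deriv_le`), and it eventually lies below about `G / ν²`, where `G` bounds both `|g_j|²`.

One weight may be zero, so `X` need not control both fields. By symmetry take `θ₁ ≥ 1/2`; then `X`
controls `v₂`, and `v₁` is reached through `y = ‖w‖²`. The polarised enstrophy identity
(`inner_B_sub_stokes_sub`) leaves `(B(w,w), A v₂)` as the only nonlinear term that does not involve
`P_K`. It makes `y` grow at a rate proportional to `|A v₂|²`, while the high modes damp `y` at a
rate of order `ν K²` (`high_modes_poincare`, `difference_deriv_le`). The growth rate is not bounded
pointwise, but its mean is controlled by the dissipation in the inequality for `X`. The product `y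
exp(c X)`, with `c` chosen so that the two terms in `|A v₂|²` cancel, decays as soon as `K`
dominates the Grashof number (`decay_of_differential_inequalities`). Hence `y → 0`, and `‖v₁‖² +
‖v₂‖² ≤ 2 y + 6 X` gives the bound.

All energy identities in time are obtained by differentiating single Fourier modes and summing
(`IsPrimitiveH.energy`). -/

noncomputable section

/-! ### Absolutely continuous functions on the half-line and Gronwall inequalities -/

namespace NSE

/-- `f` is on `[0, ∞)` a primitive of the locally integrable function `f'`. -/
def IsPrimitive (f f' : ℝ → ℝ) : Prop :=
  (∀ T, 0 ≤ T → IntervalIntegrable f' volume 0 T) ∧ ∀ t, 0 ≤ t → f t = f 0 + ∫ s in (0 : ℝ)..t, f' s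

namespace IsPrimitive

variable {f f' g g' : ℝ → ℝ}

theorem sub_eq (h : IsPrimitive f f') {s t : ℝ} (hs : 0 ≤ s) (ht : 0 ≤ t) :
    f t - f s = ∫ r in s..t, f' r := by
  rw [h.2 t ht, h.2 s hs, ← intervalIntegral.integral_interval_sub_left (h.1 t ht) (h.1 s hs)]
  ring

theorem congr_deriv (h : IsPrimitive f f') (hg : ∀ᵐ t ∂volume.restrict (Set.Ioi (0 : ℝ)), f' t = g' t) :
    IsPrimitive f g' := by
  have key : ∀ t, 0 ≤ t → ∀ᵐ s, s ∈ Set.uIoc 0 t → f' s = g' s := by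
    intro t ht
    filter_upwards [(ae_restrict_iff' measurableSet_Ioi).1 hg] with s hs hst
    rw [Set.uIoc_of_le ht] at hst
    exact hs hst.1
  refine ⟨fun T hT => (h.1 T hT).congr_ae ?_, fun t ht => ?_⟩
  · exact (ae_restrict_iff' measurableSet_uIoc).2 (key T hT)
  · rw [h.2 t ht, intervalIntegral.integral_congr_ae (key t ht)]

theorem add (hf : IsPrimitive f f') (hg : IsPrimitive g g') :
    IsPrimitive (fun t => f t + g t) (fun t => f' t + g' t) := by
  refine ⟨fun T hT => (hf.1 T hT).add (hg.1 T hT), fun t ht => ?_⟩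
  beta_reduce
  rw [intervalIntegral.integral_add (hf.1 t ht) (hg.1 t ht), hf.2 t ht, hg.2 t ht]
  ring

theorem const_mul (c : ℝ) (hf : IsPrimitive f f') :
    IsPrimitive (fun t => c * f t) (fun t => c * f' t) := by
  refine ⟨fun T hT => (hf.1 T hT).const_mul c, fun t ht => ?_⟩
  beta_reduce
  rw [intervalIntegral.integral_const_mul, hf.2 t ht]
  ring

theorem sum {ι : Type*} (s : Finset ι) {f f' : ι → ℝ → ℝ} (h : ∀ i ∈ s, IsPrimitive (f i) (f' i)) :
    IsPrimitive (fun t => ∑ i ∈ s, f i t) (fun t => ∑ i ∈ s, f' i t) := by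
  classical
  induction s using Finset.induction_on with
  | empty => exact ⟨fun T _ => by simp, fun t _ => by simp⟩
  | insert a s ha ih =>
    simp only [Finset.sum_insert ha]
    exact (h a (by simp)).add (ih fun i hi => h i (by simp [hi]))

theorem absolutelyContinuous (h : IsPrimitive f f') {T : ℝ} (hT : 0 ≤ T) :
    AbsolutelyContinuousOnInterval f 0 T := by
  have h1 := (h.1 T hT).absolutelyContinuousOnInterval_intervalIntegral (c := 0) (by simp)
  have h2 : AbsolutelyContinuousOnInterval (fun _ : ℝ => f 0) 0 T :=
    (contDiffOn_const).absolutelyContinuousOnInterval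
  have h3 := h2.add h1
  rw [absolutelyContinuousOnInterval_iff] at h3 ⊢
  intro ε hε
  obtain ⟨δ, hδ, H⟩ := h3 ε hε
  refine ⟨δ, hδ, fun E hE hlen => ?_⟩
  convert H E hE hlen using 2 with i hi
  have hm := hE.1 i hi
  rw [Set.uIcc_of_le hT] at hm
  simp only [Pi.add_apply]
  rw [← h.2 _ hm.1.1, ← h.2 _ hm.2.1]

theorem continuousOn (h : IsPrimitive f f') : ContinuousOn f (Set.Ici 0) := by
  intro t ht
  have h1 := (h.absolutelyContinuous (T := t + 1) (by linarith [Set.mem_Ici.1 ht])).continuousOn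
  rw [Set.uIcc_of_le (by linarith [Set.mem_Ici.1 ht])] at h1
  refine (h1 t ⟨ht, by linarith⟩).mono_of_mem_nhdsWithin ?_
  have : Set.Iio (t + 1) ∈ 𝓝 t := Iio_mem_nhds (by linarith)
  filter_upwards [nhdsWithin_le_nhds this, self_mem_nhdsWithin] with x hx hx'
  exact ⟨hx', hx.le⟩

theorem ae_hasDerivAt (h : IsPrimitive f f') :
    ∀ᵐ t ∂volume.restrict (Set.Ioi (0 : ℝ)), HasDerivAt f (f' t) t := by
  rw [ae_restrict_iff' measurableSet_Ioi]
  have h1 : ∀ n : ℕ, ∀ᵐ t : ℝ, t ∈ Set.uIcc (0 : ℝ) n →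
      HasDerivAt (fun x => ∫ s in (0 : ℝ)..x, f' s) (f' t) t := fun n => by
    have := (h.1 n n.cast_nonneg).ae_hasDerivAt_integral
    filter_upwards [this] with t ht htm
    exact ht htm 0 (by simp)
  filter_upwards [ae_all_iff.2 h1] with t ht htpos
  obtain ⟨n, hn⟩ := exists_nat_ge t
  have h2 := (ht n (by rw [Set.uIcc_of_le n.cast_nonneg]; exact ⟨le_of_lt htpos, hn⟩)).const_add (f 0)
  refine h2.congr_of_eventuallyEq ?_
  filter_upwards [Ioi_mem_nhds (Set.mem_Ioi.1 htpos)] with s hs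
  exact h.2 s (le_of_lt hs)

/-- This is the fundamental theorem of calculus for absolutely continuous functions. Through it,
products and exponentials only need absolute continuity and an almost everywhere chain rule. -/
theorem of_absolutelyContinuous (h : ∀ T, 0 ≤ T → AbsolutelyContinuousOnInterval f 0 T)
    (hd : ∀ᵐ t ∂volume.restrict (Set.Ioi (0 : ℝ)), HasDerivAt f (f' t) t) : IsPrimitive f f' := by
  have : IsPrimitive f (deriv f) :=
    ⟨fun T hT => (h T hT).intervalIntegrable_deriv, fun t ht => by
      rw [(h t ht).integral_deriv_eq_sub]; ring⟩
  exact this.congr_deriv (hd.mono fun t ht => ht.deriv)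

theorem mul (hf : IsPrimitive f f') (hg : IsPrimitive g g') :
    IsPrimitive (fun t => f t * g t) (fun t => f' t * g t + f t * g' t) := by
  refine of_absolutelyContinuous
    (fun T hT => (hf.absolutelyContinuous hT).mul (hg.absolutelyContinuous hT)) ?_
  filter_upwards [hf.ae_hasDerivAt, hg.ae_hasDerivAt] with t h1 h2
  exact h1.mul h2

theorem exp (hf : IsPrimitive f f') :
    IsPrimitive (fun t => Real.exp (f t)) (fun t => Real.exp (f t) * f' t) := by
  refine of_absolutelyContinuous (fun T hT => ?_) ?_
  · have hac := hf.absolutelyContinuous hT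
    -- On the bounded range of `f` over `[0, T]` the exponential is Lipschitz, and composing with a
    -- Lipschitz map preserves absolute continuity. Dividing `ε` by `L + 1` covers the case `L = 0`.
    obtain ⟨C, hC⟩ := hac.exists_bound
    obtain ⟨L, hL⟩ := (Real.contDiff_exp (n := 1)).contDiffOn.exists_lipschitzOnWith (by decide)
      (convex_Icc (-C) C) isCompact_Icc
    rw [absolutelyContinuousOnInterval_iff] at hac ⊢
    intro ε hε
    obtain ⟨δ, hδ, H⟩ := hac (ε / (L + 1)) (by positivity)
    refine ⟨δ, hδ, fun E hE hlen => ?_⟩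
    have h1 := H E hE hlen
    rw [lt_div_iff₀ (by positivity)] at h1
    refine lt_of_le_of_lt ?_ h1
    rw [Finset.sum_mul]
    refine Finset.sum_le_sum fun i hi => ?_
    have hm := hE.1 i hi
    have h2 := hL.dist_le_mul _ (abs_le.1 (hC _ hm.1)) _ (abs_le.1 (hC _ hm.2))
    refine h2.trans ?_
    rw [mul_comm]
    gcongr
    linarith
  · filter_upwards [hf.ae_hasDerivAt] with t h1
    exact h1.exp

theorem of_contDiff {φ : ℝ → ℝ} (h : ContDiff ℝ 1 φ) : IsPrimitive φ (deriv φ) :=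
  of_absolutelyContinuous (fun _ _ => h.contDiffOn.absolutelyContinuousOnInterval)
    (Eventually.of_forall fun t => (h.differentiable (by norm_num) t).hasDerivAt)

/-- Gronwall's inequality for `f' ≤ - c f + b` from a time `T` on. -/
theorem le_of_deriv_le (hf : IsPrimitive f f') {b c T : ℝ} (hc : 0 < c) (hT : 0 ≤ T)
    (h : ∀ᵐ t ∂volume.restrict (Set.Ioi T), f' t ≤ -c * f t + b) {t : ℝ} (ht : T ≤ t) :
    f t ≤ b / c + (f T - b / c) * Real.exp (-c * (t - T)) := by
  have hE : IsPrimitive (fun t => Real.exp (c * t)) (deriv fun t => Real.exp (c * t)) :=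
    of_contDiff (by fun_prop)
  have hconst : IsPrimitive (fun _ => -(b / c)) (deriv fun _ => -(b / c)) :=
    of_contDiff contDiff_const
  -- The hypothesis says exactly that `(f - b / c) exp(c t)` has a nonpositive derivative almost
  -- everywhere after `T`.
  have hp := (hf.add hconst).mul hE
  have h1 := hp.sub_eq hT (hT.trans ht)
  have h2 : ∫ r in T..t, ((f' r + deriv (fun _ => -(b / c)) r) * Real.exp (c * r) +
      (f r + -(b / c)) * deriv (fun t => Real.exp (c * t)) r) ≤ 0 := by
    rw [← neg_nonneg, ← intervalIntegral.integral_neg]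
    refine intervalIntegral.integral_nonneg_of_ae_restrict ht ?_
    have h' : ∀ᵐ t ∂volume.restrict (Set.Icc T t), f' t ≤ -c * f t + b := by
      rw [Measure.restrict_congr_set Ioc_ae_eq_Icc.symm]
      exact ae_restrict_of_ae_restrict_of_subset (fun x hx => hx.1) h
    filter_upwards [h'] with r hr
    have hd : deriv (fun t => Real.exp (c * t)) r = Real.exp (c * r) * c := by
      have := ((hasDerivAt_id r).const_mul c).exp
      simpa using this.deriv
    rw [hd, deriv_const]
    have e : -((f' r + 0) * Real.exp (c * r) + (f r + -(b / c)) * (Real.exp (c * r) * c))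
        = Real.exp (c * r) * (-c * f r + b - f' r) := by
      field_simp
      ring
    simp only [Pi.zero_apply]
    rw [e]
    exact mul_nonneg (Real.exp_nonneg _) (by linarith)
  rw [← h1] at h2
  have h3 : Real.exp (-c * (t - T)) = Real.exp (c * T) * Real.exp (-(c * t)) := by
    rw [← Real.exp_add]; ring_nf
  have h4 : (f t - b / c) ≤ (f T - b / c) * Real.exp (-c * (t - T)) := by
    rw [h3, ← mul_assoc]
    rw [Real.exp_neg, ← div_eq_mul_inv, le_div_iff₀ (Real.exp_pos _)]
    linarith
  linarith

/-- The value at the starting time is forgotten exponentially, so the inequality is needed only from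
some late time on. This is what lets vanishing perturbations be absorbed. -/
theorem eventually_le_of_deriv_le (hf : IsPrimitive f f') {b c : ℝ} (hc : 0 < c)
    (h : ∀ᶠ T in atTop, ∀ᵐ t ∂volume.restrict (Set.Ioi T), f' t ≤ -c * f t + b) {ε : ℝ}
    (hε : 0 < ε) : ∀ᶠ t in atTop, f t ≤ b / c + ε := by
  obtain ⟨T, hT, hT0⟩ := (h.and (eventually_ge_atTop 0)).exists
  have h1 : Tendsto (fun t => b / c + (f T - b / c) * Real.exp (-c * (t - T))) atTop
      (𝓝 (b / c + (f T - b / c) * 0)) := by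
    refine tendsto_const_nhds.add (tendsto_const_nhds.mul (Real.tendsto_exp_atBot.comp ?_))
    exact (tendsto_atTop_add_const_right _ (-T) tendsto_id).const_mul_atTop_of_neg (by linarith)
  have h2 := h1.eventually (Iio_mem_nhds (show b / c + (f T - b / c) * 0 < b / c + ε by linarith))
  filter_upwards [h2, eventually_ge_atTop T] with t ht htT
  exact (hf.le_of_deriv_le hc hT0 hT htT).trans (le_of_lt ht)

theorem tendsto_zero_of_deriv_le (hf : IsPrimitive f f') (hf0 : ∀ t, 0 ≤ t → 0 ≤ f t) {c : ℝ} (hc : 0 < c)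
    (h : ∀ b, 0 < b → ∀ᶠ T in atTop, ∀ᵐ t ∂volume.restrict (Set.Ioi T), f' t ≤ -c * f t + b) :
    Tendsto f atTop (𝓝 0) := by
  rw [Metric.tendsto_nhds]
  intro ε hε
  have h1 := hf.eventually_le_of_deriv_le hc (h (c * (ε / 3)) (by positivity)) (ε := ε / 3) (by positivity)
  filter_upwards [h1, eventually_ge_atTop 0] with t ht ht0
  rw [Real.dist_0_eq_abs, abs_of_nonneg (hf0 t ht0)]
  rw [mul_div_cancel_left₀ _ hc.ne'] at ht
  linarith

end IsPrimitive

end NSE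

end

noncomputable section

/-! ### Fourier series on the two-dimensional torus -/

namespace NSE

open scoped ComplexConjugate

theorem expMode_neg (k : Fin 2 → ℤ) (x : Torus) : expMode (-k) x = conj (expMode k x) := by
  simp only [expMode, Pi.neg_apply, fourier_neg, map_prod]

theorem expMode_add (k l : Fin 2 → ℤ) (x : Torus) :
    expMode (k + l) x = expMode k x * expMode l x := by
  simp only [expMode, Pi.add_apply, fourier_add, ← Finset.prod_mul_distrib]

theorem expMode_zero (x : Torus) : expMode 0 x = 1 := by
  simp [expMode]

/-- The integral is the inner product of the zeroth and the `n`-th exponential of the orthonormal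
system, rescaled from the normalised Haar measure. -/
theorem integral_fourier (n : ℤ) :
    ∫ x : AddCircle (2 * Real.pi), fourier n x = if n = 0 then ((2 * Real.pi : ℝ) : ℂ) else 0 := by
  have h := (orthonormal_iff_ite.mp (orthonormal_fourier (T := 2 * Real.pi))) 0 n
  simp only [ContinuousMap.inner_toLp, ← fourier_neg, ← fourier_add] at h
  simp only [neg_zero, add_zero] at h
  rw [AddCircle.integral_haarAddCircle] at h
  have hpi : (2 * Real.pi) ≠ 0 := Real.two_pi_pos.ne'
  rw [inv_smul_eq_iff₀ hpi] at h
  rw [h]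
  by_cases hn : n = 0
  · simp [hn]
  · simp [hn, Ne.symm hn]

theorem integral_expMode (m : Fin 2 → ℤ) :
    ∫ x : Torus, expMode m x = if m = 0 then (((2 * Real.pi) ^ 2 : ℝ) : ℂ) else 0 := by
  simp only [expMode]
  rw [integral_fintype_prod_volume_eq_prod (fun i (y : AddCircle (2 * Real.pi)) => fourier (m i) y)]
  simp only [integral_fourier]
  split_ifs with h
  · simp [h]
  · obtain ⟨i, hi⟩ := Function.ne_iff.mp h
    exact Finset.prod_eq_zero (Finset.mem_univ i) (by simpa using hi)

/-- The exponential as a continuous map. -/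
def expModeC (k : Fin 2 → ℤ) : C(Torus, ℂ) := ⟨expMode k, continuous_expMode k⟩

-- Stone–Weierstrass: the exponentials are closed under products and conjugation, so their span is a
-- star algebra, and the first exponential in each coordinate already separates points.
open Algebra Submodule in
theorem span_expModeC_closure :
    (span ℂ (Set.range expModeC)).topologicalClosure = ⊤ := by
  let S : StarSubalgebra ℂ C(Torus, ℂ) :=
    { toSubalgebra := Algebra.adjoin ℂ (Set.range expModeC)
      star_mem' := by
        change Algebra.adjoin ℂ (Set.range expModeC) ≤ star (Algebra.adjoin ℂ (Set.range expModeC))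
        refine adjoin_le ?_
        rintro _ ⟨n, rfl⟩
        refine subset_adjoin ⟨-n, ?_⟩
        ext1 x
        exact expMode_neg n x }
  have hS : S.toSubalgebra.toSubmodule = span ℂ (Set.range expModeC) := by
    apply adjoin_eq_span_of_subset
    refine .trans (fun x ↦ Submonoid.closure_induction (fun _ ↦ id) ⟨0, ?_⟩ ?_) subset_span
    · ext z
      exact expMode_zero z
    · rintro _ _ _ _ ⟨m, rfl⟩ ⟨n, rfl⟩
      refine ⟨m + n, ?_⟩
      ext z
      exact expMode_add m n z
  have hsep : S.SeparatesPoints := by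
    intro x y hxy
    obtain ⟨i, hi⟩ := Function.ne_iff.mp hxy
    refine ⟨_, ⟨expModeC (Pi.single i 1), subset_adjoin ⟨Pi.single i 1, rfl⟩, rfl⟩, ?_⟩
    have hval : ∀ z : Torus, expModeC (Pi.single i 1) z = fourier 1 (z i) := fun z => by
      change ∏ j, fourier ((Pi.single i (1 : ℤ) : Fin 2 → ℤ) j) (z j) = _
      rw [Finset.prod_eq_single i]
      · simp
      · intro j _ hj
        rw [Pi.single_eq_of_ne hj, fourier_zero]
      · simp
    dsimp only
    rw [hval, hval, fourier_one, fourier_one]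
    contrapose hi
    replace hi := Circle.ext hi
    exact AddCircle.injective_toCircle Real.two_pi_pos.ne' hi
  rw [← hS]
  exact congr_arg (Subalgebra.toSubmodule <| StarSubalgebra.toSubalgebra ·)
    (ContinuousMap.starSubalgebra_topologicalClosure_eq_top_of_separatesPoints S hsep)

/-- The normalised exponential in the complex `L²` space. -/
def expLp (k : Fin 2 → ℤ) : Lp ℂ 2 (volume : Measure Torus) :=
  ((2 * Real.pi)⁻¹ : ℂ) • ContinuousMap.toLp (E := ℂ) 2 volume ℂ (expModeC k)

theorem two_pi_ne_zero' : (2 * Real.pi : ℂ) ≠ 0 := by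
  exact_mod_cast Real.two_pi_pos.ne'

theorem orthonormal_expLp : Orthonormal ℂ expLp := by
  rw [orthonormal_iff_ite]
  intro m n
  simp only [expLp, inner_smul_left, inner_smul_right, ContinuousMap.inner_toLp]
  have h : ∀ x, expModeC n x * conj (expModeC m x) = expMode (n - m) x := fun x => by
    rw [sub_eq_add_neg, expMode_add, expMode_neg]; rfl
  simp only [h, integral_expMode]
  by_cases hmn : m = n
  · simp only [hmn, sub_self, if_true]
    have := two_pi_ne_zero'
    simp [map_ofNat (starRingEnd ℂ) 2]
    field_simp
  · simp [hmn, sub_eq_zero, Ne.symm hmn]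

theorem span_expLp_closure :
    (Submodule.span ℂ (Set.range expLp)).topologicalClosure = ⊤ := by
  have h1 : (Submodule.span ℂ (Set.range fun k =>
      ContinuousMap.toLp (E := ℂ) 2 (volume : Measure Torus) ℂ (expModeC k))).topologicalClosure = ⊤ := by
    simpa only [Submodule.map_span, ContinuousLinearMap.coe_coe, ← Set.range_comp, Function.comp_def] using
      (ContinuousMap.toLp_denseRange ℂ (volume : Measure Torus) ℂ (p := 2)
        (by norm_num)).topologicalClosure_map_submodule span_expModeC_closure
  rw [eq_top_iff, ← h1]
  refine Submodule.topologicalClosure_mono (Submodule.span_le.2 ?_)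
  rintro _ ⟨k, rfl⟩
  have h2 : ContinuousMap.toLp (E := ℂ) 2 (volume : Measure Torus) ℂ (expModeC k)
      = (2 * Real.pi : ℂ) • expLp k := by
    rw [expLp, smul_smul, mul_inv_cancel₀ two_pi_ne_zero', one_smul]
  simp only [h2]
  exact Submodule.smul_mem _ _ (Submodule.subset_span ⟨k, rfl⟩)

/-- The Hilbert basis of normalised exponentials. -/
def expBasis : HilbertBasis (Fin 2 → ℤ) ℂ (Lp ℂ 2 (volume : Measure Torus)) :=
  HilbertBasis.mk orthonormal_expLp span_expLp_closure.ge

/-- The Fourier coefficients of a scalar function. -/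
def coef (f : Torus → ℂ) (k : Fin 2 → ℤ) : ℂ :=
  (((2 * Real.pi) ^ 2)⁻¹ : ℂ) * ∫ x : Torus, expMode (-k) x * f x

theorem fourierCoef_eq_coef (u : L2) (k : Fin 2 → ℤ) (j : Fin 2) :
    fourierCoef u k j = coef (fun x => ((u x j : ℝ) : ℂ)) k := rfl

theorem coef_congr_ae {f g : Torus → ℂ} (h : f =ᵐ[volume] g) : coef f = coef g := by
  funext k
  unfold coef
  congr 1
  exact integral_congr_ae (h.mono fun x hx => by simp only [hx])

theorem inner_expBasis {f : Torus → ℂ} (hf : MemLp f 2 volume) (k : Fin 2 → ℤ) :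
    inner ℂ (expBasis k) (hf.toLp f) = (2 * Real.pi : ℂ) * coef f k := by
  have h0 : expBasis k = expLp k := by rw [expBasis, HilbertBasis.coe_mk]
  rw [h0, expLp, inner_smul_left, L2.inner_def, coef]
  have h1 : ∫ x, inner ℂ ((ContinuousMap.toLp (E := ℂ) 2 (volume : Measure Torus) ℂ (expModeC k)) x)
      (hf.toLp f x) = ∫ x, expMode (-k) x * f x := by
    refine integral_congr_ae ?_
    filter_upwards [ContinuousMap.coeFn_toLp (𝕜 := ℂ) (p := 2) (volume : Measure Torus) (expModeC k),
      hf.coeFn_toLp] with x hx hx'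
    rw [hx, hx', expMode_neg, RCLike.inner_apply, mul_comm]
    rfl
  rw [h1]
  have := two_pi_ne_zero'
  simp [map_ofNat (starRingEnd ℂ) 2]
  field_simp

/-- Parseval's identity in the Hilbert basis `expBasis`, rescaled to the unnormalised coefficients.
-/
theorem hasSum_coef_mul {f g : Torus → ℂ} (hf : MemLp f 2 volume) (hg : MemLp g 2 volume) :
    HasSum (fun k => conj (coef f k) * coef g k)
      ((((2 * Real.pi) ^ 2)⁻¹ : ℂ) * ∫ x, conj (f x) * g x) := by
  have h := (expBasis.hasSum_inner_mul_inner (hf.toLp f) (hg.toLp g)).mul_left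
    (((2 * Real.pi) ^ 2)⁻¹ : ℂ)
  have h1 : inner ℂ (hf.toLp f) (hg.toLp g) = ∫ x, conj (f x) * g x := by
    rw [L2.inner_def]
    refine integral_congr_ae ?_
    filter_upwards [hf.coeFn_toLp, hg.coeFn_toLp] with x hx hx'
    rw [hx, hx', RCLike.inner_apply, mul_comm]
  rw [h1] at h
  refine h.congr_fun fun k => ?_
  rw [← inner_conj_symm, inner_expBasis, inner_expBasis, map_mul]
  have := two_pi_ne_zero'
  simp [map_ofNat (starRingEnd ℂ) 2]
  field_simp

theorem ae_eq_of_coef_eq {f g : Torus → ℂ} (hf : MemLp f 2 volume) (hg : MemLp g 2 volume)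
    (h : ∀ k, coef f k = coef g k) : f =ᵐ[volume] g := by
  have h1 : hf.toLp f = hg.toLp g := by
    refine expBasis.repr.injective ?_
    ext k
    rw [expBasis.repr_apply_apply, expBasis.repr_apply_apply, inner_expBasis, inner_expBasis, h]
  exact (MemLp.toLp_eq_toLp_iff hf hg).1 h1

theorem coef_expMode_mul (f : Torus → ℂ) (k m : Fin 2 → ℤ) :
    coef (fun x => expMode k x * f x) m = coef f (m - k) := by
  unfold coef
  congr 2
  funext x
  rw [← mul_assoc, ← expMode_add]
  congr 2
  abel

theorem coef_tsum {a : (Fin 2 → ℤ) → ℂ} (ha : Summable fun k => ‖a k‖) (m : Fin 2 → ℤ) :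
    coef (fun x => ∑' k, a k * expMode k x) m = a m := by
  have h2 : ∀ k, ∫ x : Torus, expMode (-m) x * (a k * expMode k x) = (a k) * (if k = m then (2 * Real.pi : ℂ) ^ 2 else 0) := by
    intro k
    have h : ∀ x, expMode (-m) x * (a k * expMode k x) = a k * expMode (k - m) x := fun x => by
      rw [sub_eq_add_neg, expMode_add]; ring
    simp only [h, integral_const_mul, integral_expMode, sub_eq_zero]
    push_cast
    rfl
  have h1 : HasSum (fun k => ∫ x : Torus, expMode (-m) x * (a k * expMode k x))
      (∫ x : Torus, ∑' k, expMode (-m) x * (a k * expMode k x)) := by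
    refine hasSum_integral_of_summable_integral_norm (fun k => ?_) ?_
    · exact (((continuous_expMode _).mul (continuous_const.mul
        (continuous_expMode k)))).integrable_of_hasCompactSupport (HasCompactSupport.of_compactSpace _)
    · simp only [norm_mul, norm_expMode, one_mul, mul_one, integral_const, smul_eq_mul]
      exact ha.mul_left _
  simp only [tsum_mul_left] at h1
  unfold coef
  rw [← h1.tsum_eq]
  simp only [h2]
  rw [tsum_eq_single m (fun k hk => by simp [hk])]
  have := two_pi_ne_zero'
  simp
  field_simp

theorem continuous_tsum_expMode {a : (Fin 2 → ℤ) → ℂ} (ha : Summable fun k => ‖a k‖) :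
    Continuous fun x => ∑' k, a k * expMode k x :=
  continuous_tsum (fun k => continuous_const.mul (continuous_expMode k)) ha
    fun k x => by rw [norm_mul, norm_expMode, mul_one]

theorem memLp_of_continuous {f : Torus → ℂ} (hf : Continuous f) : MemLp f 2 volume := by
  obtain ⟨C, hC⟩ := isCompact_univ.exists_bound_of_continuousOn hf.continuousOn
  exact MemLp.of_bound hf.aestronglyMeasurable C (Eventually.of_forall fun x => hC x trivial)

/-- The uniformly convergent series defines a continuous function with the same coefficients as `f`,
and completeness of the exponentials identifies the two. -/
theorem ae_hasSum_coef {f : Torus → ℂ} (hf : MemLp f 2 volume) (hs : Summable fun k => ‖coef f k‖) :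
    ∀ᵐ x, HasSum (fun k => coef f k * expMode k x) (f x) := by
  have h := ae_eq_of_coef_eq (memLp_of_continuous (continuous_tsum_expMode hs)) hf
    fun k => coef_tsum hs k
  filter_upwards [h] with x hx
  rw [← hx]
  refine Summable.hasSum (Summable.of_norm ?_)
  simpa only [norm_mul, norm_expMode, mul_one] using hs

end NSE

end

noncomputable section

/-! ### Fourier multipliers on `H` and the norms of `V` and `D(A)` -/

namespace NSE

open scoped ComplexConjugate InnerProductSpace

theorem memLp_coord (u : L2) (j : Fin 2) :
    MemLp (fun x : Torus => ((u x j : ℝ) : ℂ)) 2 volume := by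
  have h2 : MemLp (fun x : Torus => u x j) 2 volume :=
    (EuclideanSpace.proj (𝕜 := ℝ) j).comp_memLp' (Lp.memLp u)
  exact h2.ofReal

theorem fourierCoef_sub (u v : L2) (k : Fin 2 → ℤ) (j : Fin 2) :
    fourierCoef (u - v) k j = fourierCoef u k j - fourierCoef v k j := by
  have h := fourierCoef_add (u - v) v k j
  rw [sub_add_cancel] at h
  rw [h]; ring

theorem fourierCoef_neg_index (u : L2) (k : Fin 2 → ℤ) (j : Fin 2) :
    fourierCoef u (-k) j = conj (fourierCoef u k j) := by
  unfold fourierCoef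
  rw [map_mul, ← integral_conj]
  congr 1
  · simp [map_ofNat (starRingEnd ℂ) 2]
  · congr 1
    funext x
    rw [map_mul, expMode_neg, Complex.conj_ofReal, expMode_neg]

/-- The contribution of the wavenumber `k` to the inner product of `L²`. -/
def modeInner (u w : L2) (k : Fin 2 → ℤ) : ℝ :=
  (2 * Real.pi) ^ 2 * ∑ j, (conj (fourierCoef u k j) * fourierCoef w k j).re

theorem hasSum_modeInner (u w : L2) : HasSum (modeInner u w) ⟪u, w⟫_ℝ := by
  have h : ∀ j, HasSum (fun k => (2 * Real.pi) ^ 2 * (conj (fourierCoef u k j) * fourierCoef w k j).re)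
      (∫ x, u x j * w x j) := by
    intro j
    have h1 := (Complex.hasSum_re (hasSum_coef_mul (memLp_coord u j) (memLp_coord w j))).mul_left
      ((2 * Real.pi) ^ 2)
    have h2 : ∫ x, conj ((u x j : ℝ) : ℂ) * ((w x j : ℝ) : ℂ) = ((∫ x, u x j * w x j : ℝ) : ℂ) := by
      simp only [Complex.conj_ofReal, ← Complex.ofReal_mul]
      exact integral_complex_ofReal
    have h3 : (((2 * Real.pi) ^ 2)⁻¹ : ℂ) = ((((2 * Real.pi) ^ 2)⁻¹ : ℝ) : ℂ) := by push_cast; rfl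
    rw [h2, h3, ← Complex.ofReal_mul, Complex.ofReal_re, mul_inv_cancel_left₀ (by positivity)] at h1
    exact h1
  have h2 := hasSum_sum (s := Finset.univ) fun j _ => h j
  have h3 : ⟪u, w⟫_ℝ = ∑ j, ∫ x, u x j * w x j := by
    rw [L2.inner_def, ← integral_finsetSum]
    · refine integral_congr_ae (Eventually.of_forall fun x => ?_)
      simp only [PiLp.inner_apply, RCLike.inner_apply, conj_trivial]
      exact Finset.sum_congr rfl fun j _ => mul_comm _ _
    · intro j _
      have h4 := L2.integrable_inner (𝕜 := ℂ) ((memLp_coord u j).toLp _) ((memLp_coord w j).toLp _)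
      have h5 : Integrable (fun x => (((u x j * w x j : ℝ)) : ℂ)) := by
        refine h4.congr ?_
        filter_upwards [(memLp_coord u j).coeFn_toLp, (memLp_coord w j).coeFn_toLp] with x hx hx'
        rw [hx, hx', RCLike.inner_apply, Complex.conj_ofReal]
        push_cast
        ring
      simpa using h5.re
  rw [h3]
  refine h2.congr_fun fun k => ?_
  rw [modeInner, Finset.mul_sum]

theorem modeInner_self (u : L2) (k : Fin 2 → ℤ) :
    modeInner u u k = (2 * Real.pi) ^ 2 * ∑ j, ‖fourierCoef u k j‖ ^ 2 := by
  unfold modeInner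
  congr 1
  refine Finset.sum_congr rfl fun j _ => ?_
  rw [mul_comm, Complex.mul_conj, Complex.ofReal_re, Complex.normSq_eq_norm_sq]

theorem modeInner_self_nonneg (u : L2) (k : Fin 2 → ℤ) : 0 ≤ modeInner u u k := by
  rw [modeInner_self]; positivity

theorem hasSum_modeInner_self (u : L2) : HasSum (modeInner u u) (‖u‖ ^ 2) := by
  rw [← real_inner_self_eq_norm_sq]; exact hasSum_modeInner u u

theorem abs_modeInner_le (u w : L2) (k : Fin 2 → ℤ) :
    |modeInner u w k| ≤ (modeInner u u k + modeInner w w k) / 2 := by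
  rw [modeInner_self, modeInner_self, modeInner, abs_mul, abs_of_nonneg (by positivity), ← mul_add,
    mul_div_assoc, ← Finset.sum_add_distrib, Finset.sum_div]
  gcongr
  refine (Finset.abs_sum_le_sum_abs _ _).trans (Finset.sum_le_sum fun j _ => ?_)
  refine (Complex.abs_re_le_norm _).trans ?_
  rw [norm_mul, RCLike.norm_conj]
  nlinarith [sq_nonneg (‖fourierCoef u k j‖ - ‖fourierCoef w k j‖)]

theorem L2_ext {u w : L2} (h : ∀ k j, fourierCoef u k j = fourierCoef w k j) : u = w := by
  have h1 := hasSum_modeInner_self (u - w)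
  have h2 : modeInner (u - w) (u - w) = fun _ => 0 := by
    funext k
    simp [modeInner_self, fourierCoef_sub, h]
  rw [h2] at h1
  have h3 := h1.unique hasSum_zero
  rw [← sub_eq_zero, ← norm_eq_zero]
  exact pow_eq_zero_iff (two_ne_zero) |>.1 h3

section Multiplier

variable {m : (Fin 2 → ℤ) → ℂ} {u v w z : H}

/-- Fourier coefficients determine a field. Hence the choice made in `multiplier` is immaterial, and
multipliers are computed by exhibiting any field with the right coefficients. -/
theorem IsMultiplier.unique (h : IsMultiplier m u w) (h' : IsMultiplier m u z) : w = z :=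
  Subtype.ext (L2_ext fun k j => by rw [h k j, h' k j])

theorem IsMultiplier.multiplier_eq (h : IsMultiplier m u w) : multiplier m u = w := by
  have hex : ∃ w, IsMultiplier m u w := ⟨w, h⟩
  rw [multiplier, dif_pos hex]
  exact hex.choose_spec.unique h

theorem isMultiplier_multiplier (h : ∃ w, IsMultiplier m u w) : IsMultiplier m u (multiplier m u) := by
  rw [multiplier, dif_pos h]
  exact h.choose_spec

theorem IsMultiplier.add (h : IsMultiplier m u w) (h' : IsMultiplier m v z) :
    IsMultiplier m (u + v) (w + z) := fun k j => by
  rw [Submodule.coe_add, Submodule.coe_add, fourierCoef_add, fourierCoef_add, h k j, h' k j, mul_add]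

theorem IsMultiplier.sub (h : IsMultiplier m u w) (h' : IsMultiplier m v z) :
    IsMultiplier m (u - v) (w - z) := fun k j => by
  rw [Submodule.coe_sub, Submodule.coe_sub, fourierCoef_sub, fourierCoef_sub, h k j, h' k j, mul_sub]

theorem modeInner_of_isMultiplier {m : (Fin 2 → ℤ) → ℝ} (h : IsMultiplier (fun k => (m k : ℂ)) u w)
    (v : L2) (k : Fin 2 → ℤ) : modeInner v w k = m k * modeInner v u k := by
  unfold modeInner
  rw [mul_left_comm, Finset.mul_sum _ _ (m k)]
  congr 1
  refine Finset.sum_congr rfl fun j _ => ?_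
  rw [h k j, mul_left_comm, Complex.re_ofReal_mul]

theorem modeInner_comm (u w : L2) (k : Fin 2 → ℤ) : modeInner u w k = modeInner w u k := by
  unfold modeInner
  congr 1
  refine Finset.sum_congr rfl fun j _ => ?_
  rw [← Complex.conj_re, map_mul, Complex.conj_conj, mul_comm]

theorem inner_isMultiplier_comm {m : (Fin 2 → ℤ) → ℝ} (hu : IsMultiplier (fun k => (m k : ℂ)) u w)
    (hv : IsMultiplier (fun k => (m k : ℂ)) v z) : ⟪w, v⟫_ℝ = ⟪u, z⟫_ℝ := by
  have h1 : HasSum (modeInner w v) ⟪w, v⟫_ℝ := hasSum_modeInner (w : L2) v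
  have h2 : HasSum (modeInner u z) ⟪u, z⟫_ℝ := hasSum_modeInner (u : L2) z
  have h3 : modeInner w v = modeInner u z := by
    funext k
    rw [modeInner_comm, modeInner_of_isMultiplier hu, modeInner_of_isMultiplier hv, modeInner_comm]
  rw [h3] at h1
  exact h1.unique h2

/-- The field is the sum of its absolutely convergent series. An even real symbol keeps it real, and
a scalar symbol keeps it divergence-free and mean-free. -/
theorem exists_isMultiplier {m : (Fin 2 → ℤ) → ℝ} (hm : ∀ k, m (-k) = m k) (u : H)
    (hs : ∀ j, Summable fun k => ‖(m k : ℂ) * fourierCoef u k j‖) :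
    ∃ w, IsMultiplier (fun k => (m k : ℂ)) u w := by
  let F : Fin 2 → Torus → ℂ := fun j x => ∑' k, (m k : ℂ) * fourierCoef u k j * expMode k x
  have hF : ∀ j, Continuous (F j) := fun j => continuous_tsum_expMode (hs j)
  have hreal : ∀ j x, (((F j x).re : ℝ) : ℂ) = F j x := by
    intro j x
    rw [← Complex.conj_eq_iff_re]
    simp only [F]
    rw [Complex.conj_tsum, ← (Equiv.neg (Fin 2 → ℤ)).tsum_eq]
    refine tsum_congr fun k => ?_
    simp only [Equiv.neg_apply, map_mul, hm, Complex.conj_ofReal, fourierCoef_neg_index,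
      expMode_neg, Complex.conj_conj]
  let G : C(Torus, Vec) := ⟨fun x => WithLp.toLp 2 fun j => (F j x).re,
    (PiLp.continuous_toLp 2 _).comp (continuous_pi fun j => Complex.continuous_re.comp (hF j))⟩
  let g : L2 := ContinuousMap.toLp (E := Vec) 2 volume ℝ G
  have hg : ∀ k j, fourierCoef g k j = (m k : ℂ) * fourierCoef u k j := by
    intro k j
    rw [fourierCoef_eq_coef, ← coef_tsum (hs j) k]
    refine congrFun (coef_congr_ae ?_) k
    filter_upwards [ContinuousMap.coeFn_toLp (𝕜 := ℝ) (p := 2) (volume : Measure Torus) G] with x hx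
    rw [hx]
    exact hreal j x
  refine ⟨⟨g, fun j => ?_, fun k => ?_⟩, hg⟩
  · rw [hg, u.2.1 j, mul_zero]
  · simp only [hg, mul_left_comm _ (m k : ℂ)]
    rw [← Finset.mul_sum, u.2.2 k, mul_zero]

end Multiplier

theorem sqLen_neg (k : Fin 2 → ℤ) : sqLen (-k) = sqLen k := by simp [sqLen]

theorem sqLen_nonneg (k : Fin 2 → ℤ) : 0 ≤ sqLen k := by unfold sqLen; positivity

theorem one_le_sqLen {k : Fin 2 → ℤ} (hk : k ≠ 0) : 1 ≤ sqLen k := by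
  obtain ⟨i, hi⟩ := Function.ne_iff.mp hk
  have h1 : (1 : ℤ) ≤ (k i) ^ 2 := by
    have := sq_pos_of_ne_zero (show k i ≠ 0 from hi)
    linarith
  have h2 : (1 : ℝ) ≤ (k i : ℝ) ^ 2 := by exact_mod_cast h1
  exact h2.trans (Finset.single_le_sum (f := fun i => (k i : ℝ) ^ 2) (fun i _ => sq_nonneg _)
    (Finset.mem_univ i))

theorem finite_low_modes (K : ℝ) : {k : Fin 2 → ℤ | √(sqLen k) ≤ K}.Finite := by
  refine (Set.Finite.pi' (t := fun _ : Fin 2 => Set.Icc (-⌈K⌉) ⌈K⌉) fun _ => Set.finite_Icc _ _).subset ?_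
  intro k hk i
  have h1 : |(k i : ℝ)| ≤ K := by
    refine le_trans ?_ hk
    rw [← Real.sqrt_sq_eq_abs]
    exact Real.sqrt_le_sqrt (Finset.single_le_sum (f := fun i => (k i : ℝ) ^ 2)
      (fun i _ => sq_nonneg _) (Finset.mem_univ i))
  have h2 := abs_le.1 (h1.trans (Int.le_ceil K))
  constructor
  · exact_mod_cast h2.1
  · exact_mod_cast h2.2

/-- The symbol of `P_K` as a real number. -/
def lowMode (K : ℝ) (k : Fin 2 → ℤ) : ℝ := if √(sqLen k) ≤ K then 1 else 0

theorem projSymbol_eq (K : ℝ) : projSymbol K = fun k => (lowMode K k : ℂ) := by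
  funext k
  simp only [projSymbol, lowMode]
  split_ifs <;> simp

theorem isMultiplier_proj (K : ℝ) (u : H) : IsMultiplier (fun k => (lowMode K k : ℂ)) u (proj K u) := by
  unfold proj
  rw [projSymbol_eq]
  refine isMultiplier_multiplier (exists_isMultiplier (fun k => ?_) u fun j => ?_)
  · simp only [lowMode, sqLen_neg]
  · refine summable_of_hasFiniteSupport ((finite_low_modes K).subset fun k hk => ?_)
    by_contra h
    exact hk (by simp [lowMode, show ¬ √(sqLen k) ≤ K from h])

theorem fourierCoef_proj (K : ℝ) (u : H) (k : Fin 2 → ℤ) (j : Fin 2) :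
    fourierCoef (proj K u) k j = (lowMode K k : ℂ) * fourierCoef u k j := isMultiplier_proj K u k j

theorem proj_sub (K : ℝ) (u v : H) : proj K (u - v) = proj K u - proj K v :=
  (isMultiplier_proj K (u - v)).unique ((isMultiplier_proj K u).sub (isMultiplier_proj K v))

theorem inner_proj_left (K : ℝ) (u v : H) : ⟪proj K u, v⟫_ℝ = ⟪u, proj K v⟫_ℝ :=
  inner_isMultiplier_comm (isMultiplier_proj K u) (isMultiplier_proj K v)

theorem lowMode_mul_self (K : ℝ) (k : Fin 2 → ℤ) : lowMode K k * lowMode K k = lowMode K k := by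
  unfold lowMode; split_ifs <;> simp

theorem proj_proj (K : ℝ) (u : H) : proj K (proj K u) = proj K u :=
  (isMultiplier_proj K (proj K u)).unique fun k j => by
    rw [fourierCoef_proj, ← mul_assoc, ← Complex.ofReal_mul, lowMode_mul_self]

/-! ### The spaces `V` and `D(A)` -/

theorem isMultiplier_partialDeriv {u : H} (hu : u ∈ V) (j : Fin 2) :
    IsMultiplier (derivSymbol j) u (partialDeriv j u) := isMultiplier_multiplier (hu j)

theorem isMultiplier_stokes {u : H} (hu : u ∈ domStokes) :
    IsMultiplier (fun k => (sqLen k : ℂ)) u (stokes u) := isMultiplier_multiplier hu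

theorem V_sub {u v : H} (hu : u ∈ V) (hv : v ∈ V) : u - v ∈ V := fun j =>
  ⟨_, (isMultiplier_partialDeriv hu j).sub (isMultiplier_partialDeriv hv j)⟩

theorem domStokes_sub {u v : H} (hu : u ∈ domStokes) (hv : v ∈ domStokes) : u - v ∈ domStokes :=
  ⟨_, (isMultiplier_stokes hu).sub (isMultiplier_stokes hv)⟩

theorem partialDeriv_add {u v : H} (hu : u ∈ V) (hv : v ∈ V) (j : Fin 2) :
    partialDeriv j (u + v) = partialDeriv j u + partialDeriv j v :=
  ((isMultiplier_partialDeriv hu j).add (isMultiplier_partialDeriv hv j)).multiplier_eq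

theorem partialDeriv_sub {u v : H} (hu : u ∈ V) (hv : v ∈ V) (j : Fin 2) :
    partialDeriv j (u - v) = partialDeriv j u - partialDeriv j v :=
  ((isMultiplier_partialDeriv hu j).sub (isMultiplier_partialDeriv hv j)).multiplier_eq

theorem stokes_add {u v : H} (hu : u ∈ domStokes) (hv : v ∈ domStokes) :
    stokes (u + v) = stokes u + stokes v :=
  ((isMultiplier_stokes hu).add (isMultiplier_stokes hv)).multiplier_eq

theorem stokes_sub {u v : H} (hu : u ∈ domStokes) (hv : v ∈ domStokes) :
    stokes (u - v) = stokes u - stokes v :=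
  ((isMultiplier_stokes hu).sub (isMultiplier_stokes hv)).multiplier_eq

theorem normV_nonneg (u : H) : 0 ≤ normV u := Real.sqrt_nonneg _

theorem normV_sq (u : H) : normV u ^ 2 = ∑ j, ‖partialDeriv j u‖ ^ 2 :=
  Real.sq_sqrt (by positivity)

theorem normV_eq_norm (u : H) :
    normV u = ‖(WithLp.toLp 2 fun j => partialDeriv j u : PiLp 2 fun _ : Fin 2 => H)‖ := by
  rw [PiLp.norm_eq_of_L2]; rfl

theorem normV_add_le {u v : H} (hu : u ∈ V) (hv : v ∈ V) : normV (u + v) ≤ normV u + normV v := by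
  simp only [normV_eq_norm, partialDeriv_add hu hv]
  exact norm_add_le (WithLp.toLp 2 fun j => partialDeriv j u : PiLp 2 fun _ : Fin 2 => H)
    (WithLp.toLp 2 fun j => partialDeriv j v)

theorem norm_partialDeriv_le (u : H) (j : Fin 2) : ‖partialDeriv j u‖ ≤ normV u := by
  refine Real.le_sqrt_of_sq_le ?_
  exact Finset.single_le_sum (f := fun j => ‖partialDeriv j u‖ ^ 2) (fun i _ => sq_nonneg _)
    (Finset.mem_univ j)

theorem hasSum_normV_sq {u : H} (hu : u ∈ V) :
    HasSum (fun k => sqLen k * modeInner u u k) (normV u ^ 2) := by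
  rw [normV_sq]
  have h := hasSum_sum (s := Finset.univ) fun (j : Fin 2) _ => hasSum_modeInner_self (partialDeriv j u : L2)
  refine h.congr_fun fun k => ?_
  simp only [modeInner_self, isMultiplier_partialDeriv hu _ k, derivSymbol, norm_mul, Complex.norm_I,
    one_mul, mul_pow, Complex.norm_intCast, sq_abs]
  simp only [sqLen, Fin.sum_univ_two]
  ring

theorem modeInner_zero (u : H) : modeInner u u 0 = 0 := by
  simp [modeInner_self, u.2.1]

/-- Mean-free fields have no zero mode, and every other integer wavenumber has length at least one.
All Poincaré inequalities with constant one below come from this. -/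
theorem modeInner_le_sqLen_mul (u : H) (k : Fin 2 → ℤ) :
    modeInner u u k ≤ sqLen k * modeInner u u k := by
  by_cases hk : k = 0
  · simp [hk, modeInner_zero]
  · exact le_mul_of_one_le_left (modeInner_self_nonneg _ _) (one_le_sqLen hk)

theorem norm_le_normV {u : H} (hu : u ∈ V) : ‖u‖ ≤ normV u := by
  refine le_of_sq_le_sq ?_ (normV_nonneg u)
  exact hasSum_le (modeInner_le_sqLen_mul u) (hasSum_modeInner_self (u : L2)) (hasSum_normV_sq hu)

theorem hasSum_stokes_sq {u : H} (hu : u ∈ domStokes) :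
    HasSum (fun k => sqLen k ^ 2 * modeInner u u k) (‖stokes u‖ ^ 2) := by
  refine (hasSum_modeInner_self (stokes u : L2)).congr_fun fun k => ?_
  rw [modeInner_of_isMultiplier (isMultiplier_stokes hu), modeInner_comm (stokes u : L2),
    modeInner_of_isMultiplier (isMultiplier_stokes hu)]
  ring

theorem normV_le_norm_stokes {u : H} (hu : u ∈ V) (hu' : u ∈ domStokes) : normV u ≤ ‖stokes u‖ := by
  refine le_of_sq_le_sq ?_ (norm_nonneg _)
  refine hasSum_le (fun k => ?_) (hasSum_normV_sq hu) (hasSum_stokes_sq hu')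
  rw [sq, mul_assoc]
  exact mul_le_mul_of_nonneg_left (modeInner_le_sqLen_mul u k) (sqLen_nonneg k)

end NSE

end

noncomputable section

/-! ### The embedding of `D(A)` into bounded fields and estimates of `B` -/

namespace NSE

open scoped ComplexConjugate InnerProductSpace

/-- Comparison with the lattice sum of `‖k‖⁻⁴` in the maximum norm, which converges because four
exceeds the dimension two. -/
theorem summable_inv_sqLen_sq : Summable fun k : Fin 2 → ℤ => ((sqLen k)⁻¹) ^ 2 := by
  have h := EisensteinSeries.summable_one_div_norm_rpow (k := 4) (by norm_num)
  refine h.of_nonneg_of_le (fun k => by positivity) fun k => ?_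
  by_cases hk : k = 0
  · simp only [hk, sqLen]
    simp
  have hpos : 0 < ‖k‖ := norm_pos_iff.2 hk
  have h1 : ‖k‖ ^ 2 ≤ sqLen k := by
    obtain ⟨i, hi⟩ : ∃ i, ‖k‖ = ‖k i‖ := by
      obtain ⟨i, -, hi⟩ := Finset.exists_mem_eq_sup' Finset.univ_nonempty fun i => ‖k i‖₊
      refine ⟨i, ?_⟩
      rw [Pi.norm_def, ← Finset.sup'_eq_sup Finset.univ_nonempty, hi]
      rfl
    rw [hi, Int.norm_eq_abs, sq_abs]
    exact Finset.single_le_sum (f := fun i => (k i : ℝ) ^ 2) (fun i _ => sq_nonneg _)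
      (Finset.mem_univ i)
  rw [Real.rpow_neg hpos.le, inv_pow]
  refine inv_anti₀ (by positivity) ?_
  have : ‖k‖ ^ (4 : ℝ) = (‖k‖ ^ 2) ^ 2 := by
    rw [← pow_mul]; exact_mod_cast Real.rpow_natCast ‖k‖ 4
  rw [this]
  exact pow_le_pow_left₀ (by positivity) h1 2

/-- The constant of the embedding of `D(A)` into `L^∞`. -/
def embConst : ℝ := √(∑' k : Fin 2 → ℤ, ((sqLen k)⁻¹) ^ 2)

theorem embConst_nonneg : 0 ≤ embConst := Real.sqrt_nonneg _

theorem sq_norm_fourierCoef_le (u : L2) (k : Fin 2 → ℤ) (j : Fin 2) :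
    ‖fourierCoef u k j‖ ^ 2 ≤ modeInner u u k := by
  rw [modeInner_self]
  have h1 : ‖fourierCoef u k j‖ ^ 2 ≤ ∑ j, ‖fourierCoef u k j‖ ^ 2 :=
    Finset.single_le_sum (f := fun j => ‖fourierCoef u k j‖ ^ 2) (fun i _ => sq_nonneg _)
      (Finset.mem_univ j)
  have h2 : (1 : ℝ) ≤ (2 * Real.pi) ^ 2 := by nlinarith [Real.pi_gt_three]
  exact h1.trans (le_mul_of_one_le_left (by positivity) h2)

theorem summable_sq_norm_fourierCoef (u : L2) (j : Fin 2) :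
    Summable fun k => ‖fourierCoef u k j‖ ^ 2 :=
  (hasSum_modeInner_self u).summable.of_nonneg_of_le (fun _ => by positivity)
    fun k => sq_norm_fourierCoef_le u k j

theorem tsum_sq_norm_fourierCoef_le (u : L2) (j : Fin 2) :
    ∑' k, ‖fourierCoef u k j‖ ^ 2 ≤ ‖u‖ ^ 2 := by
  rw [← (hasSum_modeInner_self u).tsum_eq]
  exact (summable_sq_norm_fourierCoef u j).tsum_le_tsum (fun k => sq_norm_fourierCoef_le u k j)
    (hasSum_modeInner_self u).summable

/-- Cauchy–Schwarz for the factorisation of a coefficient into `|k|⁻²` and the coefficient of `Au`.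
At `k = 0` the convention `0⁻¹ = 0` agrees with the vanishing mean. -/
theorem summable_fourierCoef_and_tsum_le {u : H} (hu : u ∈ domStokes) (j : Fin 2) :
    (Summable fun k => ‖fourierCoef u k j‖) ∧
      ∑' k, ‖fourierCoef u k j‖ ≤ embConst * ‖stokes u‖ := by
  have h := Real.summable_and_inner_le_Lp_mul_Lq_tsum_of_nonneg (p := 2) (q := 2)
    Real.HolderConjugate.two_two (f := fun k => (sqLen k)⁻¹)
    (g := fun k => ‖fourierCoef (stokes u) k j‖)
    (fun k => inv_nonneg.2 (sqLen_nonneg k)) (fun k => norm_nonneg _)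
    (by simpa only [Real.rpow_two] using summable_inv_sqLen_sq)
    (by simpa only [Real.rpow_two] using summable_sq_norm_fourierCoef (stokes u : L2) j)
  have he : (fun k => (sqLen k)⁻¹ * ‖fourierCoef (stokes u) k j‖) = fun k => ‖fourierCoef u k j‖ := by
    funext k
    rw [isMultiplier_stokes hu k j, norm_mul, Complex.norm_real, Real.norm_of_nonneg (sqLen_nonneg k)]
    by_cases hk : k = 0
    · simp [hk, u.2.1 j]
    · rw [inv_mul_cancel_left₀ (by linarith [one_le_sqLen hk])]
  simp only [Real.rpow_two] at h
  rw [he] at h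
  refine ⟨h.1, h.2.trans ?_⟩
  rw [← Real.sqrt_eq_rpow, ← Real.sqrt_eq_rpow]
  refine mul_le_mul_of_nonneg_left ?_ embConst_nonneg
  exact Real.sqrt_le_iff.2 ⟨norm_nonneg _, tsum_sq_norm_fourierCoef_le (stokes u : L2) j⟩

theorem ae_abs_le_of_summable {u : L2} {j : Fin 2} (h : Summable fun k => ‖fourierCoef u k j‖) :
    ∀ᵐ x, |u x j| ≤ ∑' k, ‖fourierCoef u k j‖ := by
  filter_upwards [ae_hasSum_coef (memLp_coord u j) h] with x hx
  have h1 : ‖((u x j : ℝ) : ℂ)‖ ≤ ∑' k, ‖coef (fun x => ((u x j : ℝ) : ℂ)) k * expMode k x‖ := by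
    rw [← hx.tsum_eq]
    refine norm_tsum_le_tsum_norm ?_
    simpa only [norm_mul, norm_expMode, mul_one, fourierCoef_eq_coef] using h
  simpa only [norm_mul, norm_expMode, mul_one, Complex.norm_real, Real.norm_eq_abs,
    fourierCoef_eq_coef] using h1

theorem ae_abs_le_stokes {u : H} (hu : u ∈ domStokes) (j : Fin 2) :
    ∀ᵐ x, |(u : L2) x j| ≤ embConst * ‖stokes u‖ := by
  have h := summable_fourierCoef_and_tsum_le hu j
  filter_upwards [ae_abs_le_of_summable h.1] with x hx
  exact hx.trans h.2

theorem exists_smul_ae_eq {a : Torus → ℝ} {C : ℝ} (ha : AEStronglyMeasurable a volume)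
    (hC : ∀ᵐ x, |a x| ≤ C) (f : L2) :
    ∃ g : L2, (∀ᵐ x, g x = a x • f x) ∧ ‖g‖ ≤ C * ‖f‖ := by
  have hle : ∀ᵐ x, ‖a x • f x‖ ≤ C * ‖f x‖ := by
    filter_upwards [hC] with x hx
    rw [norm_smul]
    exact mul_le_mul_of_nonneg_right hx (norm_nonneg _)
  have hm : MemLp (fun x => a x • f x) 2 volume :=
    (Lp.memLp f).of_le_mul (ha.smul (Lp.aestronglyMeasurable f)) hle
  refine ⟨hm.toLp _, hm.coeFn_toLp, Lp.norm_le_mul_norm_of_ae_le_mul ?_⟩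
  filter_upwards [hm.coeFn_toLp, hle] with x hx hx'
  rw [hx]; exact hx'

theorem aestronglyMeasurable_coord (u : L2) (j : Fin 2) :
    AEStronglyMeasurable (fun x => u x j) volume :=
  (EuclideanSpace.proj (𝕜 := ℝ) j).continuous.comp_aestronglyMeasurable (Lp.aestronglyMeasurable u)

/-- Since `u` is bounded, the product is square-integrable. So `B u v` takes the value given by the
Leray projection and not the default zero; the factor two counts the two terms of the advection. -/
theorem exists_advect_ae_eq {u : H} (hu : u ∈ domStokes) (v : H) :
    ∃ f : L2, f =ᵐ[volume] advect u v ∧ ‖f‖ ≤ 2 * embConst * (‖stokes u‖ * normV v) := by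
  choose g hg hg' using fun j => exists_smul_ae_eq (aestronglyMeasurable_coord (u : L2) j)
    (ae_abs_le_stokes hu j) (partialDeriv j v : L2)
  refine ⟨∑ j, g j, ?_, ?_⟩
  · simp only [Fin.sum_univ_two]
    filter_upwards [Lp.coeFn_add (g 0) (g 1), hg 0, hg 1] with x hx h0 h1
    rw [hx, Pi.add_apply, h0, h1, advect, Fin.sum_univ_two]
  · refine (norm_sum_le _ _).trans ?_
    have h1 : ∀ j, ‖g j‖ ≤ embConst * ‖stokes u‖ * normV v := fun j =>
      (hg' j).trans (mul_le_mul_of_nonneg_left (norm_partialDeriv_le v j)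
        (mul_nonneg embConst_nonneg (norm_nonneg _)))
    refine (Finset.sum_le_sum fun j _ => h1 j).trans (le_of_eq ?_)
    simp only [Fin.sum_univ_two]
    ring

theorem B_eq_leray {u v : H} {f : L2} (h : f =ᵐ[volume] advect u v) : B u v = leray f := by
  have hm : MemLp (advect u v) 2 volume := (memLp_congr_ae h).1 (Lp.memLp f)
  rw [B, dif_pos hm]
  congr 1
  rw [← Lp.toLp_coeFn f (Lp.memLp f)]
  exact (MemLp.toLp_eq_toLp_iff _ _).2 h.symm

theorem leray_add (f g : L2) : leray (f + g) = leray f + leray g := map_add _ _ _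

theorem norm_leray_le (f : L2) : ‖leray f‖ ≤ ‖f‖ := H.norm_orthogonalProjectionOnto_apply_le f

theorem inner_leray (f : L2) (φ : H) : ⟪leray f, φ⟫_ℝ = ⟪f, (φ : L2)⟫_ℝ :=
  H.inner_orthogonalProjectionOnto_eq_of_mem_right φ f

theorem norm_B_le {u : H} (hu : u ∈ domStokes) (v : H) :
    ‖B u v‖ ≤ 2 * embConst * (‖stokes u‖ * normV v) := by
  obtain ⟨f, hf, hf'⟩ := exists_advect_ae_eq hu v
  rw [B_eq_leray hf]
  exact (norm_leray_le f).trans hf'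

theorem B_add_left {u u' : H} (hu : u ∈ domStokes) (hu' : u' ∈ domStokes) (v : H) :
    B (u + u') v = B u v + B u' v := by
  obtain ⟨f, hf, -⟩ := exists_advect_ae_eq hu v
  obtain ⟨f', hf', -⟩ := exists_advect_ae_eq hu' v
  rw [B_eq_leray hf, B_eq_leray hf', ← leray_add]
  refine B_eq_leray ?_
  filter_upwards [hf, hf', Lp.coeFn_add f f', Lp.coeFn_add (u : L2) u'] with x h1 h2 h3 h4
  rw [h3, Pi.add_apply, h1, h2, advect, advect, advect, ← Finset.sum_add_distrib]
  refine Finset.sum_congr rfl fun j _ => ?_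
  rw [Submodule.coe_add, h4, Pi.add_apply, PiLp.add_apply, add_smul]

theorem B_sub_left {u u' : H} (hu : u ∈ domStokes) (hu' : u' ∈ domStokes) (v : H) :
    B (u - u') v = B u v - B u' v := by
  rw [eq_sub_iff_add_eq, ← B_add_left (domStokes_sub hu hu') hu', sub_add_cancel]

theorem B_add_right {u : H} (hu : u ∈ domStokes) {v v' : H} (hv : v ∈ V) (hv' : v' ∈ V) :
    B u (v + v') = B u v + B u v' := by
  obtain ⟨f, hf, -⟩ := exists_advect_ae_eq hu v
  obtain ⟨f', hf', -⟩ := exists_advect_ae_eq hu v'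
  rw [B_eq_leray hf, B_eq_leray hf', ← leray_add]
  refine B_eq_leray ?_
  filter_upwards [hf, hf', Lp.coeFn_add f f', ae_all_iff.2 fun j =>
    Lp.coeFn_add (partialDeriv j v : L2) (partialDeriv j v')] with x h1 h2 h3 h4
  rw [h3, Pi.add_apply, h1, h2, advect, advect, advect, ← Finset.sum_add_distrib]
  refine Finset.sum_congr rfl fun j _ => ?_
  rw [partialDeriv_add hv hv', Submodule.coe_add, h4, Pi.add_apply, smul_add]

theorem B_sub_right {u : H} (hu : u ∈ domStokes) {v v' : H} (hv : v ∈ V) (hv' : v' ∈ V) :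
    B u (v - v') = B u v - B u v' := by
  rw [eq_sub_iff_add_eq, ← B_add_right hu (V_sub hv hv') hv', sub_add_cancel]

/-! ### Testing with finitely many modes -/

/-- Only finitely many modes occur and each coefficient is at most the `L²` norm. The constant is
the number of modes; its size plays no role later. -/
theorem exists_low_modes_bound (K : ℝ) : ∃ C, 0 ≤ C ∧ ∀ (u : H) (j : Fin 2),
    ∀ᵐ x, |(proj K u : L2) x j| ≤ C * ‖proj K u‖ := by
  refine ⟨(finite_low_modes K).toFinset.card, by positivity, fun u j => ?_⟩
  have hzero : ∀ k ∉ (finite_low_modes K).toFinset, ‖fourierCoef (proj K u) k j‖ = 0 := by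
    intro k hk
    have : ¬ √(sqLen k) ≤ K := by simpa using hk
    simp [fourierCoef_proj, lowMode, this]
  have hs : Summable fun k => ‖fourierCoef (proj K u) k j‖ := summable_of_ne_finset_zero hzero
  filter_upwards [ae_abs_le_of_summable hs] with x hx
  refine hx.trans ?_
  rw [tsum_eq_sum hzero, ← nsmul_eq_mul]
  refine Finset.sum_le_card_nsmul _ _ _ fun k _ => ?_
  refine le_of_sq_le_sq ?_ (norm_nonneg _)
  refine (sq_norm_fourierCoef_le _ k j).trans ?_
  exact le_hasSum (hasSum_modeInner_self (proj K u : L2)) k fun l _ => modeInner_self_nonneg _ _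

theorem integral_norm_sq_L2 (f : L2) : Integrable (fun x => ‖f x‖ ^ 2) ∧ ∫ x, ‖f x‖ ^ 2 = ‖f‖ ^ 2 := by
  constructor
  · exact (Lp.memLp f).integrable_norm_pow (by norm_num)
  · rw [← real_inner_self_eq_norm_sq, L2.inner_def]
    exact integral_congr_ae (Eventually.of_forall fun x => (real_inner_self_eq_norm_sq _).symm)

/-- A test field with finitely many modes is bounded, so the trilinear form needs only `u` and its
gradient in `L²`. It is therefore quadratic in the `V` norm and free of `Au`, which makes the
coupling a small multiple of the enstrophy. -/
theorem exists_inner_B_low_modes_bound (K : ℝ) : ∃ C, 0 ≤ C ∧ ∀ u φ : H, u ∈ domStokes → u ∈ V →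
    |⟪B u u, proj K φ⟫_ℝ| ≤ C * ‖proj K φ‖ * normV u ^ 2 := by
  obtain ⟨C, hC, hb⟩ := exists_low_modes_bound K
  refine ⟨4 * C, by positivity, fun u φ hu hV => ?_⟩
  obtain ⟨f, hf, -⟩ := exists_advect_ae_eq hu u
  rw [B_eq_leray hf, inner_leray, L2.inner_def]
  set D : ℝ := C * ‖proj K φ‖ with hD
  have hD0 : 0 ≤ D := by positivity
  have hint : Integrable (fun x => D * ∑ j, (‖(u : L2) x‖ ^ 2 + ‖(partialDeriv j u : L2) x‖ ^ 2)) :=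
    (integrable_finsetSum _ fun j _ => (integral_norm_sq_L2 u).1.add
      (integral_norm_sq_L2 (partialDeriv j u)).1).const_mul D
  have hle : ∀ᵐ x, ‖⟪f x, (proj K φ : L2) x⟫_ℝ‖ ≤
      D * ∑ j, (‖(u : L2) x‖ ^ 2 + ‖(partialDeriv j u : L2) x‖ ^ 2) := by
    filter_upwards [hf, ae_all_iff.2 (hb φ)] with x hx hx'
    refine (norm_inner_le_norm _ _).trans ?_
    have h1 : ‖(proj K φ : L2) x‖ ≤ 2 * D := by
      rw [EuclideanSpace.norm_eq]
      refine Real.sqrt_le_iff.2 ⟨by positivity, ?_⟩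
      simp only [Fin.sum_univ_two, Real.norm_eq_abs]
      nlinarith [pow_le_pow_left₀ (abs_nonneg _) (hx' 0) 2, pow_le_pow_left₀ (abs_nonneg _) (hx' 1) 2]
    have h2 : ‖f x‖ ≤ ∑ j, (‖(u : L2) x‖ ^ 2 + ‖(partialDeriv j u : L2) x‖ ^ 2) / 2 := by
      rw [hx, advect]
      refine (norm_sum_le _ _).trans (Finset.sum_le_sum fun j _ => ?_)
      rw [norm_smul]
      nlinarith [sq_nonneg (‖(u : L2) x‖ - ‖(partialDeriv j u : L2) x‖),
        mul_le_mul_of_nonneg_right (PiLp.norm_apply_le ((u : L2) x) j)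
          (norm_nonneg ((partialDeriv j u : L2) x))]
    refine (mul_le_mul h2 h1 (norm_nonneg _) (Finset.sum_nonneg fun j _ => by positivity)).trans ?_
    rw [← Finset.sum_div]
    refine le_of_eq ?_
    ring
  refine (norm_integral_le_of_norm_le hint hle).trans ?_
  have hsum : ∫ x, ∑ j : Fin 2, (‖(u : L2) x‖ ^ 2 + ‖(partialDeriv j u : L2) x‖ ^ 2)
      = ∑ j : Fin 2, ∫ x, (‖(u : L2) x‖ ^ 2 + ‖(partialDeriv j u : L2) x‖ ^ 2) :=
    integral_finsetSum _ fun j _ => (integral_norm_sq_L2 u).1.add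
      (integral_norm_sq_L2 (partialDeriv j u)).1
  rw [integral_const_mul, hsum]
  have h3 : ∀ j : Fin 2, ∫ x, (‖(u : L2) x‖ ^ 2 + ‖(partialDeriv j u : L2) x‖ ^ 2)
      = ‖u‖ ^ 2 + ‖partialDeriv j u‖ ^ 2 := fun j => by
    rw [integral_add (integral_norm_sq_L2 u).1 (integral_norm_sq_L2 (partialDeriv j u)).1,
      (integral_norm_sq_L2 u).2, (integral_norm_sq_L2 (partialDeriv j u)).2]
    rfl
  simp only [h3, Finset.sum_add_distrib, ← normV_sq]
  simp only [Finset.sum_const, Finset.card_univ, Fintype.card_fin, nsmul_eq_mul]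
  have h4 : ‖u‖ ^ 2 ≤ normV u ^ 2 := pow_le_pow_left₀ (norm_nonneg _) (norm_le_normV hV) 2
  push_cast
  nlinarith

end NSE

end

noncomputable section

/-! ### Conservation of enstrophy by summation over triads -/

namespace NSE

open scoped ComplexConjugate InnerProductSpace

theorem memLp_expMode_mul {f : Torus → ℂ} (hf : MemLp f 2 volume) (m : Fin 2 → ℤ) :
    MemLp (fun x => expMode m x * f x) 2 volume :=
  hf.of_le ((continuous_expMode m).aestronglyMeasurable.mul hf.aestronglyMeasurable)
    (Eventually.of_forall fun x => by rw [norm_mul, norm_expMode, one_mul])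

theorem integrable_coord_mul (f g : L2) (i : Fin 2) :
    Integrable (fun x => (((f x i : ℝ) : ℂ)) * ((g x i : ℝ) : ℂ)) :=
  (memLp_coord f i).integrable_mul (memLp_coord g i)

/-- Parseval for `exp(-i m · x) f` and `g`; reality of `f` turns the conjugated coefficient into the
one at `-(m + k)`. -/
theorem hasSum_fourierCoef_shift (f g : L2) (i : Fin 2) (m : Fin 2 → ℤ) :
    HasSum (fun k => fourierCoef f (-(m + k)) i * fourierCoef g k i)
      ((((2 * Real.pi) ^ 2)⁻¹ : ℂ) *
        ∫ x, expMode m x * (((f x i : ℝ) : ℂ) * ((g x i : ℝ) : ℂ))) := by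
  have h := hasSum_coef_mul (memLp_expMode_mul (memLp_coord f i) (-m)) (memLp_coord g i)
  simp only [coef_expMode_mul, map_mul, Complex.conj_ofReal, ← expMode_neg, neg_neg, mul_assoc] at h
  refine h.congr_fun fun k => ?_
  rw [fourierCoef_neg_index, fourierCoef_eq_coef, fourierCoef_eq_coef, sub_neg_eq_add, add_comm]

/-- The Fourier series of the integral of a triple product. -/
theorem integral_triple_product (u f g : L2) (j i : Fin 2) (hs : Summable fun k => ‖fourierCoef u k j‖) :
    (Summable fun p : (Fin 2 → ℤ) × (Fin 2 → ℤ) =>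
      fourierCoef u p.1 j * (fourierCoef f (-(p.1 + p.2)) i * fourierCoef g p.2 i)) ∧
    ∫ x, ((u x j : ℝ) : ℂ) * (((f x i : ℝ) : ℂ) * ((g x i : ℝ) : ℂ)) =
      (2 * Real.pi : ℂ) ^ 2 * ∑' p : (Fin 2 → ℤ) × (Fin 2 → ℤ),
        fourierCoef u p.1 j * (fourierCoef f (-(p.1 + p.2)) i * fourierCoef g p.2 i) := by
  -- The bound is uniform in `m`, since a shift does not change the square sum. Multiplied by the
  -- absolutely summable coefficients of `u`, it makes the double series absolutely convergent and
  -- free to be rearranged.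
  have hbound : ∀ m, (Summable fun k => ‖fourierCoef f (-(m + k)) i * fourierCoef g k i‖) ∧
      ∑' k, ‖fourierCoef f (-(m + k)) i * fourierCoef g k i‖ ≤ ‖f‖ ^ 2 + ‖g‖ ^ 2 := by
    intro m
    let e : (Fin 2 → ℤ) ≃ (Fin 2 → ℤ) := (Equiv.addLeft m).trans (Equiv.neg _)
    have hf : Summable fun k => ‖fourierCoef f (-(m + k)) i‖ ^ 2 :=
      e.summable_iff.2 (summable_sq_norm_fourierCoef f i)
    have hf' : ∑' k, ‖fourierCoef f (-(m + k)) i‖ ^ 2 ≤ ‖f‖ ^ 2 :=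
      (e.tsum_eq fun k => ‖fourierCoef f k i‖ ^ 2).trans_le (tsum_sq_norm_fourierCoef_le f i)
    have hg := summable_sq_norm_fourierCoef g i
    have hle : ∀ k, ‖fourierCoef f (-(m + k)) i * fourierCoef g k i‖ ≤
        ‖fourierCoef f (-(m + k)) i‖ ^ 2 + ‖fourierCoef g k i‖ ^ 2 := fun k => by
      rw [norm_mul]
      nlinarith [sq_nonneg (‖fourierCoef f (-(m + k)) i‖ - ‖fourierCoef g k i‖),
        sq_nonneg (‖fourierCoef f (-(m + k)) i‖ + ‖fourierCoef g k i‖)]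
    have hsum := (hf.add hg).of_nonneg_of_le (fun k => norm_nonneg _) hle
    refine ⟨hsum, (hsum.tsum_le_tsum hle (hf.add hg)).trans ?_⟩
    rw [hf.tsum_add hg]
    exact add_le_add hf' (tsum_sq_norm_fourierCoef_le g i)
  have hsumm : Summable fun p : (Fin 2 → ℤ) × (Fin 2 → ℤ) =>
      fourierCoef u p.1 j * (fourierCoef f (-(p.1 + p.2)) i * fourierCoef g p.2 i) := by
    refine Summable.of_norm ?_
    rw [summable_prod_of_nonneg fun p => norm_nonneg _]
    simp only [norm_mul _ (_ * _ : ℂ), tsum_mul_left]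
    refine ⟨fun m => (hbound m).1.mul_left _, ?_⟩
    refine (hs.mul_right (‖f‖ ^ 2 + ‖g‖ ^ 2)).of_nonneg_of_le
      (fun m => mul_nonneg (norm_nonneg _) (tsum_nonneg fun k => norm_nonneg _)) fun m => ?_
    exact mul_le_mul_of_nonneg_left (hbound m).2 (norm_nonneg _)
  refine ⟨hsumm, ?_⟩
  have hint := integrable_coord_mul f g i
  have h1 : HasSum (fun m => ∫ x, fourierCoef u m j *
      (expMode m x * (((f x i : ℝ) : ℂ) * ((g x i : ℝ) : ℂ))))
      (∫ x, ∑' m, fourierCoef u m j * (expMode m x * (((f x i : ℝ) : ℂ) * ((g x i : ℝ) : ℂ)))) := by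
    refine hasSum_integral_of_summable_integral_norm (fun m => ?_) ?_
    · exact (hint.bdd_mul (c := 1) (continuous_expMode m).aestronglyMeasurable
        (Eventually.of_forall fun x => (norm_expMode m x).le)).const_mul _
    · have : ∀ m x, ‖fourierCoef u m j * (expMode m x * (((f x i : ℝ) : ℂ) * ((g x i : ℝ) : ℂ)))‖ =
          ‖fourierCoef u m j‖ * ‖((f x i : ℝ) : ℂ) * ((g x i : ℝ) : ℂ)‖ := fun m x => by
        rw [norm_mul, norm_mul (expMode m x), norm_expMode, one_mul]
      simp only [this, integral_const_mul]
      exact hs.mul_right _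
  have h2 : ∫ x, ∑' m, fourierCoef u m j * (expMode m x * (((f x i : ℝ) : ℂ) * ((g x i : ℝ) : ℂ))) =
      ∫ x, ((u x j : ℝ) : ℂ) * (((f x i : ℝ) : ℂ) * ((g x i : ℝ) : ℂ)) := by
    refine integral_congr_ae ?_
    filter_upwards [ae_hasSum_coef (memLp_coord u j) hs] with x hx
    rw [← hx.tsum_eq, ← tsum_mul_right]
    exact tsum_congr fun m => by rw [fourierCoef_eq_coef, mul_assoc]
  rw [h2] at h1
  rw [← h1.tsum_eq, hsumm.tsum_prod, ← tsum_mul_left]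
  refine tsum_congr fun m => ?_
  dsimp only
  rw [integral_const_mul, tsum_mul_left, (hasSum_fourierCoef_shift f g i m).tsum_eq]
  have := two_pi_ne_zero'
  field_simp

/-- The stream function of a field at the wavenumber `k`, up to a factor. -/
def stream (u : L2) (k : Fin 2 → ℤ) : ℂ :=
  (-(k 1 : ℂ) * fourierCoef u k 0 + (k 0 : ℂ) * fourierCoef u k 1) / (sqLen k : ℂ)

/-- The vector `k` turned by a right angle. -/
def turn (k : Fin 2 → ℤ) : Fin 2 → ℂ := ![-(k 1 : ℂ), (k 0 : ℂ)]

theorem turn_zero (k : Fin 2 → ℤ) : turn k 0 = -(k 1 : ℂ) := rfl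

theorem turn_one (k : Fin 2 → ℤ) : turn k 1 = (k 0 : ℂ) := rfl

/-- In the plane a vector orthogonal to `k` is a multiple of `k` turned by a right angle, so each
mode carries a single scalar. -/
theorem fourierCoef_eq_stream (u : H) (k : Fin 2 → ℤ) (j : Fin 2) :
    fourierCoef u k j = turn k j * stream u k := by
  by_cases hk : k = 0
  · have h0 : turn 0 j = 0 := by fin_cases j <;> simp [turn]
    rw [hk, u.2.1 j, h0, zero_mul]
  have hne : (sqLen k : ℂ) ≠ 0 := by
    exact_mod_cast (show sqLen k ≠ 0 by linarith [one_le_sqLen hk])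
  have hdiv := u.2.2 k
  simp only [Fin.sum_univ_two] at hdiv
  have hlen : (sqLen k : ℂ) = (k 0 : ℂ) ^ 2 + (k 1 : ℂ) ^ 2 := by
    simp [sqLen, Fin.sum_univ_two]
  rw [stream, mul_div_assoc', eq_div_iff hne, hlen]
  fin_cases j
  · simp only [Fin.zero_eta, turn_zero]
    linear_combination (k 0 : ℂ) * hdiv
  · simp only [Fin.mk_one, turn_one]
    linear_combination (k 1 : ℂ) * hdiv

/-- The interaction of three wavenumbers in `(B(u, u), Au)`. -/
def triad (ψ : (Fin 2 → ℤ) → ℂ) (m n k : Fin 2 → ℤ) : ℂ :=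
  ∑ i, ∑ j, turn m j * ψ m * (Complex.I * (n j : ℂ) * (turn n i * ψ n) *
    ((sqLen k : ℂ) * (turn k i * ψ k)))

/-- Enstrophy is conserved triad by triad: once `m + n + k = 0` is inserted, the sum over all six
permutations is a polynomial identity in the components. -/
theorem triad_symm_sum (ψ : (Fin 2 → ℤ) → ℂ) {m n k : Fin 2 → ℤ} (h : n = -(m + k)) :
    triad ψ m n k + triad ψ m k n + triad ψ k n m + triad ψ k m n + triad ψ n m k +
      triad ψ n k m = 0 := by
  have h0 : (n 0 : ℂ) = -((m 0 : ℂ) + (k 0 : ℂ)) := by rw [h]; simp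
  have h1 : (n 1 : ℂ) = -((m 1 : ℂ) + (k 1 : ℂ)) := by rw [h]; simp
  simp only [triad, turn_zero, turn_one, sqLen, Fin.sum_univ_two,
    Complex.ofReal_add, Complex.ofReal_pow, Complex.ofReal_intCast]
  rw [h0, h1]
  ring

/-- The involution `(m, k) ↦ (m, -(m + k))`. -/
def reflectSnd : ((Fin 2 → ℤ) × (Fin 2 → ℤ)) ≃ ((Fin 2 → ℤ) × (Fin 2 → ℤ)) where
  toFun p := (p.1, -(p.1 + p.2))
  invFun p := (p.1, -(p.1 + p.2))
  left_inv p := by ext <;> simp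
  right_inv p := by ext <;> simp

theorem tsum_triad_eq_zero (ψ : (Fin 2 → ℤ) → ℂ)
    (hs : Summable fun p : (Fin 2 → ℤ) × (Fin 2 → ℤ) => triad ψ p.1 (-(p.1 + p.2)) p.2) :
    ∑' p : (Fin 2 → ℤ) × (Fin 2 → ℤ), triad ψ p.1 (-(p.1 + p.2)) p.2 = 0 := by
  set F : ((Fin 2 → ℤ) × (Fin 2 → ℤ)) → ℂ := fun p => triad ψ p.1 (-(p.1 + p.2)) p.2 with hF
  let s : ((Fin 2 → ℤ) × (Fin 2 → ℤ)) ≃ ((Fin 2 → ℤ) × (Fin 2 → ℤ)) := Equiv.prodComm _ _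
  let r := reflectSnd
  have key : ∀ e : ((Fin 2 → ℤ) × (Fin 2 → ℤ)) ≃ ((Fin 2 → ℤ) × (Fin 2 → ℤ)),
      HasSum (fun p => F (e p)) (∑' p, F p) := fun e => e.hasSum_iff.2 hs.hasSum
  -- The swap `s` and the reflection `r` generate all six permutations of a triad. Each leaves the
  -- total unchanged, so six times the total is the sum of the symmetrised terms.
  have h := ((((hs.hasSum.add (key r)).add (key s)).add (key (s.trans r))).add
    (key ((r.trans s)))).add (key ((r.trans s).trans r))
  have hzero : ∀ p, F p + F (r p) + F (s p) + F ((s.trans r) p) + F ((r.trans s) p) +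
      F (((r.trans s).trans r) p) = 0 := by
    rintro ⟨m, k⟩
    have h := triad_symm_sum ψ (m := m) (n := -(m + k)) (k := k) rfl
    rw [← h]
    have e1 : -(m + -(m + k)) = k := by abel
    have e2 : -(k + m) = -(m + k) := by abel
    have e3 : -(k + -(m + k)) = m := by abel
    have e4 : -(-(m + k) + m) = k := by abel
    have e5 : -(-(m + k) + k) = m := by abel
    simp only [hF, r, s, reflectSnd, Equiv.trans_apply, Equiv.coe_fn_mk, Equiv.prodComm_apply,
      Prod.swap_prod_mk, e1, e2, e3, e4, e5]
    ring
  simp only [hzero] at h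
  have h6 := h.unique hasSum_zero
  linear_combination (1 / 6 : ℂ) * h6

theorem inner_B_eq {u : H} (hu : u ∈ domStokes) (v φ : H) :
    ⟪B u v, φ⟫_ℝ = ∑ i, ∑ j, ∫ x, (u : L2) x j * ((partialDeriv j v : L2) x i * (φ : L2) x i) := by
  obtain ⟨f, hf, -⟩ := exists_advect_ae_eq hu v
  rw [B_eq_leray hf, inner_leray, L2.inner_def]
  have hint : ∀ i j, Integrable fun x => (u : L2) x j * ((partialDeriv j v : L2) x i * (φ : L2) x i) := by
    intro i j
    have h1 : Integrable fun x => (partialDeriv j v : L2) x i * (φ : L2) x i := by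
      have := (integrable_coord_mul (partialDeriv j v : L2) (φ : L2) i).re
      simpa using this
    refine h1.bdd_mul (c := embConst * ‖stokes u‖) (aestronglyMeasurable_coord _ _) ?_
    filter_upwards [ae_abs_le_stokes hu j] with x hx
    exact hx
  simp only [← integral_finsetSum _ fun j _ => hint _ j]
  rw [← integral_finsetSum _ fun i _ => integrable_finsetSum _ fun j _ => hint i j]
  refine integral_congr_ae ?_
  filter_upwards [hf] with x hx
  rw [hx, advect]
  simp only [PiLp.inner_apply, RCLike.inner_apply, conj_trivial, Fin.sum_univ_two, PiLp.add_apply,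
    PiLp.smul_apply, smul_eq_mul]
  ring

/-- The enstrophy is conserved by the nonlinearity: `(B(u, u), Au) = 0`. -/
theorem inner_B_stokes_self {u : H} (hu : u ∈ domStokes) (hV : u ∈ V) :
    ⟪B u u, stokes u⟫_ℝ = 0 := by
  have h1 := fun i j => integral_triple_product (u : L2) (partialDeriv j u : L2) (stokes u : L2) j i
    (summable_fourierCoef_and_tsum_le hu j).1
  have hterm : ∀ p : (Fin 2 → ℤ) × (Fin 2 → ℤ), ∑ i, ∑ j,
      fourierCoef u p.1 j * (fourierCoef (partialDeriv j u) (-(p.1 + p.2)) i *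
        fourierCoef (stokes u) p.2 i) = triad (stream u) p.1 (-(p.1 + p.2)) p.2 := fun p => by
    unfold triad
    refine Finset.sum_congr rfl fun i _ => Finset.sum_congr rfl fun j _ => ?_
    rw [isMultiplier_partialDeriv hV j, isMultiplier_stokes hu, fourierCoef_eq_stream,
      fourierCoef_eq_stream, fourierCoef_eq_stream]
    rfl
  have h2 := hasSum_sum (s := Finset.univ) fun i _ => hasSum_sum (s := Finset.univ) fun j _ =>
    (h1 i j).1.hasSum
  simp only [hterm] at h2
  have hzero := h2.tsum_eq.symm.trans (tsum_triad_eq_zero _ h2.summable)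
  have hC : ((⟪B u u, stokes u⟫_ℝ : ℝ) : ℂ) = 0 := by
    rw [inner_B_eq hu]
    simp only [Complex.ofReal_sum, ← integral_complex_ofReal, Complex.ofReal_mul]
    simp only [(h1 _ _).2, ← Finset.mul_sum]
    rw [hzero, mul_zero]
  exact_mod_cast hC

/-- The polarised form of the conservation of enstrophy. -/
theorem inner_B_sub_stokes_sub {u v : H} (hu : u ∈ domStokes) (hv : v ∈ domStokes) (hu' : u ∈ V)
    (hv' : v ∈ V) :
    ⟪B u u - B v v, stokes (u - v)⟫_ℝ = -⟪B (u - v) (u - v), stokes v⟫_ℝ := by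
  obtain ⟨w, rfl⟩ : ∃ w, u = v + w := ⟨u - v, by abel⟩
  have hw : w ∈ domStokes := by simpa using domStokes_sub hu hv
  have hw' : w ∈ V := by simpa using V_sub hu' hv'
  rw [add_sub_cancel_left]
  -- Adding the identities for `v + w` and `v - w` isolates the part quadratic in `w`, once the
  -- identity for `v` removes the part cubic in `v`. The identity for `w` removes the remaining
  -- cubic term.
  have h1 := inner_B_stokes_self hu hu'
  have h2 := inner_B_stokes_self (domStokes_sub hv hw) (V_sub hv' hw')
  have h3 := inner_B_stokes_self hv hv'
  have h4 := inner_B_stokes_self hw hw'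
  rw [B_add_left hv hw, B_add_right hv hv' hw', B_add_right hw hv' hw', stokes_add hv hw] at h1
  rw [B_sub_left hv hw, B_sub_right hv hv' hw', B_sub_right hw hv' hw', stokes_sub hv hw] at h2
  rw [B_add_left hv hw, B_add_right hv hv' hw', B_add_right hw hv' hw']
  simp only [inner_add_left, inner_add_right, inner_sub_left, inner_sub_right] at h1 h2 ⊢
  linarith

end NSE

end

noncomputable section

/-! ### The abstract decay argument -/

namespace NSE

/-- Two coupled differential inequalities with asymptotically vanishing perturbations: `y` decays
although its growth rate contains `Q`, because `Q` is controlled in the mean through `X`. -/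
theorem decay_of_differential_inequalities {X X' y y' z z' Y₂ Q d : ℝ → ℝ} {ν Γ D c κ : ℝ}
    (hν : 0 < ν) (hΓ : 0 ≤ Γ) (hD : 0 ≤ D) (hc : 0 ≤ c) (hcΓ : c * Γ ≤ ν / 2 * κ)
    (hX : IsPrimitive X X') (hy : IsPrimitive y y') (hz : IsPrimitive z z')
    (hX0 : ∀ t, 0 ≤ t → 0 ≤ X t) (hy0 : ∀ t, 0 ≤ t → 0 ≤ y t) (hz0 : ∀ t, 0 ≤ t → 0 ≤ z t)
    (hY : ∀ t, 0 ≤ t → Y₂ t ≤ 2 * X t)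
    (hd : ∀ ε, 0 < ε → ∀ᶠ T in atTop, ∀ᵐ t ∂volume.restrict (Set.Ioi (T : ℝ)), d t ≤ ε)
    (hXQ : ∀ᵐ t ∂volume.restrict (Set.Ioi (0 : ℝ)),
      X' t ≤ -(ν / 2) * Q t + Γ + 2 * (D * √(z t)) * X t)
    (hXX : ∀ᵐ t ∂volume.restrict (Set.Ioi (0 : ℝ)), X' t ≤ -ν * X t + Γ + 2 * (D * √(z t)) * X t)
    (hyy : ∀ᵐ t ∂volume.restrict (Set.Ioi (0 : ℝ)),
      y' t ≤ -(ν / 2) * (1 + κ) * y t + ν / 2 * κ ^ 2 * z t + c * (ν / 2) * Q t * y t + 2 / ν * d t +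
        D * √(z t) * (4 * y t + 6 * Y₂ t))
    (hzz : ∀ᵐ t ∂volume.restrict (Set.Ioi (0 : ℝ)), z' t ≤ -ν * z t + d t / ν) :
    Tendsto y atTop (𝓝 0) ∧ ∀ ε, 0 < ε → ∀ᶠ t in atTop, X t ≤ Γ / ν + ε := by
  have hmono : ∀ {p : ℝ → Prop} {T : ℝ}, 0 ≤ T → (∀ᵐ t ∂volume.restrict (Set.Ioi (0 : ℝ)), p t) →
      ∀ᵐ t ∂volume.restrict (Set.Ioi T), p t := fun hT h =>
    ae_restrict_of_ae_restrict_of_subset (Set.Ioi_subset_Ioi hT) h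
  have hev : ∀ {p : ℝ → Prop}, (∀ᶠ t in atTop, p t) →
      ∀ᶠ T in atTop, ∀ᵐ t ∂volume.restrict (Set.Ioi T), p t := by
    intro p h
    obtain ⟨T₀, hT₀⟩ := eventually_atTop.1 h
    filter_upwards [eventually_ge_atTop T₀] with T hT
    exact (ae_restrict_iff' measurableSet_Ioi).2
      (Eventually.of_forall fun t ht => hT₀ t (hT.trans (le_of_lt ht)))
  have hz_lim : Tendsto z atTop (𝓝 0) := by
    refine hz.tendsto_zero_of_deriv_le hz0 hν fun b hb => ?_
    filter_upwards [hd (ν * b) (by positivity), eventually_ge_atTop 0] with T hT hT0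
    filter_upwards [hT, hmono hT0 hzz] with t h1 h2
    have : d t / ν ≤ b := by rw [div_le_iff₀ hν]; linarith
    linarith
  have hδ : ∀ a, 0 < a → ∀ᶠ t in atTop, D * √(z t) ≤ a := by
    intro a ha
    have h1 : Tendsto (fun t => D * √(z t)) atTop (𝓝 (D * √0)) :=
      ((Real.continuous_sqrt.tendsto 0).comp hz_lim).const_mul D
    rw [Real.sqrt_zero, mul_zero] at h1
    exact h1.eventually (Iic_mem_nhds ha)
  -- A crude bound first: half of the damping absorbs the perturbation. With `X` bounded, `√z X`
  -- becomes a vanishing additive term, which yields the sharp constant `Γ / ν` at the end.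
  have hXbar : ∀ᶠ t in atTop, X t ≤ Γ / (ν / 2) + 1 := by
    refine hX.eventually_le_of_deriv_le (by positivity) ?_ one_pos
    filter_upwards [hev (hδ (ν / 4) (by positivity)), eventually_ge_atTop 0] with T hT hT0
    filter_upwards [hT, hmono hT0 hXX, ae_restrict_mem measurableSet_Ioi] with t h1 h2 h3
    nlinarith [mul_le_mul_of_nonneg_right h1 (hX0 t (hT0.trans (le_of_lt h3)))]
  set Xb : ℝ := Γ / (ν / 2) + 1 with hXb
  have hXb0 : 0 < Xb := by positivity
  have hprod : ∀ {t : ℝ}, 0 ≤ t → X t ≤ Xb → D * √(z t) * X t ≤ D * √(z t) * Xb := fun _ h =>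
    mul_le_mul_of_nonneg_left h (mul_nonneg hD (Real.sqrt_nonneg _))
  refine ⟨?_, fun ε hε => ?_⟩
  -- In the derivative of `y exp(c X)` the growth `c (ν / 2) Q y` cancels against the dissipation in
  -- `c y X'`. The remaining `c Γ y` is absorbed by the damping `(ν / 2) κ y`, leaving the rate `ν /
  -- 2`, half of which pays for the perturbations.
  · have hE := (hX.const_mul c).exp
    have hYY := hy.mul hE
    have hlim : Tendsto (fun t => y t * Real.exp (c * X t)) atTop (𝓝 0) := by
      refine hYY.tendsto_zero_of_deriv_le
        (fun t ht => mul_nonneg (hy0 t ht) (Real.exp_nonneg _)) (c := ν / 4) (by positivity)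
        fun b hb => ?_
      -- Three additive errors remain, from `Y₂`, from `z` and from `d`. Each is made at most `β`,
      -- and the weight is at most `exp(c Xb)`, so together they stay below `b`.
      set β : ℝ := b * Real.exp (-(c * Xb)) / 3 with hβ
      have hβ0 : 0 < β := by positivity
      have e1 : ∀ᶠ t in atTop, D * √(z t) * (4 + 2 * c * Xb) ≤ ν / 4 := by
        filter_upwards [hδ (ν / 4 / (4 + 2 * c * Xb)) (by positivity)] with t ht
        rwa [le_div_iff₀ (by positivity)] at ht
      have e2 : ∀ᶠ t in atTop, D * √(z t) * (12 * Xb) ≤ β := by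
        filter_upwards [hδ (β / (12 * Xb)) (by positivity)] with t ht
        rwa [le_div_iff₀ (by positivity)] at ht
      have e3 : ∀ᶠ t in atTop, ν / 2 * κ ^ 2 * z t ≤ β := by
        have h1 : Tendsto (fun t => ν / 2 * κ ^ 2 * z t) atTop (𝓝 (ν / 2 * κ ^ 2 * 0)) :=
          hz_lim.const_mul _
        rw [mul_zero] at h1
        exact h1.eventually (Iic_mem_nhds hβ0)
      filter_upwards [hev e1, hev e2, hev e3, hev hXbar, hd (ν / 2 * β) (by positivity),
        eventually_ge_atTop 0] with T h1 h2 h3 h4 h5 hT0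
      filter_upwards [h1, h2, h3, h4, h5, hmono hT0 hXQ, hmono hT0 hyy,
        ae_restrict_mem measurableSet_Ioi] with t h1 h2 h3 h4 h5 h6 h7 ht
      have ht0 : 0 ≤ t := hT0.trans (le_of_lt ht)
      have hyt := hy0 t ht0
      have hXt := hX0 t ht0
      set E := Real.exp (c * X t)
      have hE0 : 0 < E := Real.exp_pos _
      have hEle : E ≤ Real.exp (c * Xb) :=
        Real.exp_le_exp.2 (mul_le_mul_of_nonneg_left h4 hc)
      have hδ0 : 0 ≤ D * √(z t) := mul_nonneg hD (Real.sqrt_nonneg _)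
      have g1 : c * y t * X' t ≤ c * y t * (-(ν / 2) * Q t + Γ + 2 * (D * √(z t)) * Xb) :=
        mul_le_mul_of_nonneg_left (by nlinarith [hprod ht0 h4]) (mul_nonneg hc hyt)
      have g2 : D * √(z t) * (6 * Y₂ t) ≤ β := by
        refine le_trans ?_ h2
        refine mul_le_mul_of_nonneg_left ?_ hδ0
        linarith [hY t ht0]
      have g3 : 2 / ν * d t ≤ β := by
        calc 2 / ν * d t ≤ 2 / ν * (ν / 2 * β) := mul_le_mul_of_nonneg_left h5 (by positivity)
          _ = β := by field_simp
      have g4 : c * Γ * y t ≤ ν / 2 * κ * y t := mul_le_mul_of_nonneg_right hcΓ hyt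
      have g5 : D * √(z t) * (4 + 2 * c * Xb) * y t ≤ ν / 4 * y t := mul_le_mul_of_nonneg_right h1 hyt
      have g6 : y' t + c * y t * X' t ≤ -(ν / 4) * y t + 3 * β := by linarith
      have g7 : E * (3 * β) ≤ b := by
        calc E * (3 * β) ≤ Real.exp (c * Xb) * (3 * β) :=
              mul_le_mul_of_nonneg_right hEle (by positivity)
          _ = b * (Real.exp (c * Xb) * Real.exp (-(c * Xb))) := by rw [hβ]; ring
          _ = b := by rw [← Real.exp_add]; simp
      calc y' t * E + y t * (E * (c * X' t)) = E * (y' t + c * y t * X' t) := by ring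
        _ ≤ E * (-(ν / 4) * y t + 3 * β) := mul_le_mul_of_nonneg_left g6 hE0.le
        _ = -(ν / 4) * (y t * E) + E * (3 * β) := by ring
        _ ≤ _ := by linarith
    -- The weight is at least one because `c` and `X` are nonnegative.
    refine squeeze_zero' ?_ ?_ hlim
    · filter_upwards [eventually_ge_atTop 0] with t ht using hy0 t ht
    · filter_upwards [eventually_ge_atTop 0] with t ht
      exact le_mul_of_one_le_right (hy0 t ht) (Real.one_le_exp (mul_nonneg hc (hX0 t ht)))
  · have h := hX.eventually_le_of_deriv_le hν (b := Γ + ν * (ε / 2)) ?_ (half_pos hε)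
    · filter_upwards [h] with t ht
      rw [add_div, mul_div_cancel_left₀ _ hν.ne'] at ht
      linarith
    · have e1 : ∀ᶠ t in atTop, D * √(z t) * (2 * Xb) ≤ ν * (ε / 2) := by
        filter_upwards [hδ (ν * (ε / 2) / (2 * Xb)) (by positivity)] with t ht
        rwa [le_div_iff₀ (by positivity)] at ht
      filter_upwards [hev e1, hev hXbar, eventually_ge_atTop 0] with T h1 h2 hT0
      filter_upwards [h1, h2, hmono hT0 hXX, ae_restrict_mem measurableSet_Ioi] with t h1 h2 h3 ht
      linarith [hprod (hT0.trans (le_of_lt ht)) h2]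

end NSE

end

noncomputable section

/-! ### Energy identities, mode by mode -/

namespace NSE

open scoped ComplexConjugate InnerProductSpace

/-- `v` is on `[0, ∞)` a primitive of the locally integrable `H`-valued function `R`. -/
def IsPrimitiveH (v R : ℝ → H) : Prop :=
  (∀ T, 0 < T → IntervalIntegrable R volume 0 T) ∧ ∀ t, 0 ≤ t → v t = v 0 + ∫ s in (0 : ℝ)..t, R s

/-- The Fourier coefficient as a continuous linear map on `H`. -/
def fourierCoefL (k : Fin 2 → ℤ) (j : Fin 2) : H →L[ℝ] ℂ where
  toFun u := fourierCoef u k j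
  map_add' u v := fourierCoef_add u v k j
  map_smul' c u := by simp [fourierCoef_smul]
  cont := (continuous_fourierCoef k j).comp continuous_subtype_val

theorem IsPrimitiveH.sub {v R w S : ℝ → H} (hv : IsPrimitiveH v R) (hw : IsPrimitiveH w S) :
    IsPrimitiveH (fun t => v t - w t) (fun t => R t - S t) := by
  have hi : ∀ {R : ℝ → H}, (∀ T, 0 < T → IntervalIntegrable R volume 0 T) → ∀ t, 0 ≤ t →
      IntervalIntegrable R volume 0 t := fun h t ht => by
    rcases ht.eq_or_lt with rfl | ht
    · simp
    · exact h t ht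
  refine ⟨fun T hT => (hv.1 T hT).sub (hw.1 T hT), fun t ht => ?_⟩
  beta_reduce
  rw [intervalIntegral.integral_sub (hi hv.1 t ht) (hi hw.1 t ht), hv.2 t ht, hw.2 t ht]
  abel

theorem IsPrimitiveH.comp {v R : ℝ → H} (h : IsPrimitiveH v R) (L : H →L[ℝ] ℝ) :
    IsPrimitive (fun t => L (v t)) (fun t => L (R t)) := by
  have hint : ∀ T, 0 ≤ T → IntervalIntegrable R volume 0 T := fun T hT => by
    rcases hT.eq_or_lt with rfl | hT
    · simp
    · exact h.1 T hT
  refine ⟨fun T hT => ⟨L.integrable_comp (hint T hT).1, L.integrable_comp (hint T hT).2⟩,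
    fun t ht => ?_⟩
  rw [L.intervalIntegral_comp_comm (hint t ht), ← map_add, ← h.2 t ht]

/-- Real and imaginary parts of a coefficient are continuous linear functionals, so the equation
passes to them and the product rule for scalar functions applies. -/
theorem IsPrimitiveH.modeInner {v R : ℝ → H} (h : IsPrimitiveH v R) (k : Fin 2 → ℤ) :
    IsPrimitive (fun t => modeInner (v t) (v t) k) (fun t => 2 * modeInner (v t) (R t) k) := by
  have h1 := fun j => h.comp (Complex.reCLM.comp (fourierCoefL k j))
  have h2 := fun j => h.comp (Complex.imCLM.comp (fourierCoefL k j))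
  have h3 := (IsPrimitive.sum Finset.univ fun j _ =>
    ((h1 j).mul (h1 j)).add ((h2 j).mul (h2 j))).const_mul ((2 * Real.pi) ^ 2)
  convert h3 using 2 with t t
  · unfold NSE.modeInner
    congr 1
    refine Finset.sum_congr rfl fun j _ => ?_
    rw [Complex.mul_re, Complex.conj_re, Complex.conj_im, neg_mul, sub_neg_eq_add]
    rfl
  · unfold NSE.modeInner
    rw [mul_left_comm, Finset.mul_sum _ _ (2 : ℝ)]
    congr 1
    refine Finset.sum_congr rfl fun j _ => ?_
    rw [Complex.mul_re, Complex.conj_re, Complex.conj_im, neg_mul, sub_neg_eq_add]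
    change 2 * ((fourierCoef (v t) k j).re * (fourierCoef (R t) k j).re +
      (fourierCoef (v t) k j).im * (fourierCoef (R t) k j).im) =
      (fourierCoef (R t) k j).re * (fourierCoef (v t) k j).re +
      (fourierCoef (v t) k j).re * (fourierCoef (R t) k j).re +
      ((fourierCoef (R t) k j).im * (fourierCoef (v t) k j).im +
      (fourierCoef (v t) k j).im * (fourierCoef (R t) k j).im)
    ring

theorem sum_abs_modeInner_le (u w : L2) (s : Finset (Fin 2 → ℤ)) :
    ∑ k ∈ s, |modeInner u w k| ≤ (‖u‖ ^ 2 + ‖w‖ ^ 2) / 2 := by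
  refine (Finset.sum_le_sum fun k _ => abs_modeInner_le u w k).trans ?_
  rw [← Finset.sum_div, Finset.sum_add_distrib]
  have := sum_le_hasSum s (fun k _ => modeInner_self_nonneg u k) (hasSum_modeInner_self u)
  have := sum_le_hasSum s (fun k _ => modeInner_self_nonneg w k) (hasSum_modeInner_self w)
  linarith

/-- The energy identity for the quadratic form of a Fourier multiplier. -/
theorem IsPrimitiveH.energy {v R Lv : ℝ → H} (h : IsPrimitiveH v R) {m : (Fin 2 → ℤ) → ℝ} {E : ℝ → ℝ}
    (hE : ∀ t, 0 ≤ t → HasSum (fun k => m k * NSE.modeInner (v t) (v t) k) (E t))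
    (hL : ∀ᵐ t ∂volume.restrict (Set.Ioi (0 : ℝ)), IsMultiplier (fun k => (m k : ℂ)) (v t) (Lv t))
    (hR2 : ∀ T, 0 < T → MemLp R 2 (volume.restrict (Set.Ioo 0 T)))
    (hL2 : ∀ T, 0 < T → MemLp Lv 2 (volume.restrict (Set.Ioo 0 T))) :
    IsPrimitive E (fun t => 2 * ⟪R t, Lv t⟫_ℝ) := by
  have hmode := fun k => (h.modeInner k).const_mul (m k)
  have hprod : ∀ T, 0 < T → Integrable (fun t => ‖R t‖ ^ 2 + ‖Lv t‖ ^ 2)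
      (volume.restrict (Set.Ioc 0 T)) := fun T hT => by
    rw [Measure.restrict_congr_set Ioo_ae_eq_Ioc.symm]
    exact ((hR2 T hT).integrable_norm_pow (by norm_num)).add
      ((hL2 T hT).integrable_norm_pow (by norm_num))
  have hinner : ∀ T, 0 < T → Integrable (fun t => 2 * ⟪R t, Lv t⟫_ℝ)
      (volume.restrict (Set.Ioc 0 T)) := fun T hT => by
    have hp := hprod T hT
    rw [Measure.restrict_congr_set Ioo_ae_eq_Ioc.symm] at hp ⊢
    refine hp.mono' (((hR2 T hT).aestronglyMeasurable.inner
      (hL2 T hT).aestronglyMeasurable).const_mul 2) (Eventually.of_forall fun t => ?_)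
    rw [Real.norm_eq_abs, abs_mul, abs_two]
    nlinarith [abs_real_inner_le_norm (R t) (Lv t), sq_nonneg (‖R t‖ - ‖Lv t‖)]
  refine ⟨fun T hT => ?_, fun t ht => ?_⟩
  · rcases hT.eq_or_lt with rfl | hT
    · simp
    · exact (intervalIntegrable_iff_integrableOn_Ioc_of_le hT.le).2 (hinner T hT)
  rcases ht.eq_or_lt with rfl | htpos
  · simp
  -- The symbol is moved from `v` onto `Lv`. Afterwards the sum over modes is dominated by `(|R|² +
  -- |Lv|²) / 2`, which is integrable in time, and series and integral may be exchanged.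
  have hterm : ∀ᵐ s ∂volume.restrict (Set.Ioc 0 t), ∀ k,
      m k * (2 * NSE.modeInner (v s) (R s) k) = 2 * NSE.modeInner (R s) (Lv s) k := by
    filter_upwards [ae_restrict_of_ae_restrict_of_subset Set.Ioc_subset_Ioi_self hL] with s hs k
    rw [modeInner_of_isMultiplier hs, modeInner_comm]
    ring
  have hint : ∀ k, Integrable (fun s => m k * (2 * NSE.modeInner (v s) (R s) k))
      (volume.restrict (Set.Ioc 0 t)) := fun k =>
    (intervalIntegrable_iff_integrableOn_Ioc_of_le ht).1 ((hmode k).1 t ht)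
  have hsum := hasSum_integral_of_summable_integral_norm hint ?_
  · have h1 : ∫ s in Set.Ioc 0 t, ∑' k, m k * (2 * NSE.modeInner (v s) (R s) k) =
        ∫ s in (0 : ℝ)..t, 2 * ⟪R s, Lv s⟫_ℝ := by
      rw [intervalIntegral.integral_of_le ht]
      refine integral_congr_ae ?_
      filter_upwards [hterm] with s hs
      simp only [hs]
      exact ((hasSum_modeInner (R s : L2) (Lv s)).mul_left 2).tsum_eq
    rw [h1] at hsum
    have h2 := (hE 0 le_rfl).add hsum
    refine (hE t ht).unique ?_
    convert h2 using 1
    funext k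
    rw [← intervalIntegral.integral_of_le ht]
    exact (hmode k).2 t ht
  · refine summable_of_sum_le (c := ∫ s in Set.Ioc 0 t, (‖R s‖ ^ 2 + ‖Lv s‖ ^ 2))
      (fun k => integral_nonneg fun s => norm_nonneg _) fun u => ?_
    rw [← integral_finsetSum _ fun k _ => (hint k).norm]
    refine integral_mono_ae (integrable_finsetSum _ fun k _ => (hint k).norm) (hprod t htpos) ?_
    filter_upwards [hterm] with s hs
    simp only [hs, norm_mul, ← Finset.mul_sum, Real.norm_eq_abs, abs_two]
    have h1 : ∑ k ∈ u, |NSE.modeInner (R s : L2) (Lv s) k| ≤ (‖R s‖ ^ 2 + ‖Lv s‖ ^ 2) / 2 :=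
      sum_abs_modeInner_le (R s : L2) (Lv s) u
    linarith

/-- The energy identity for finitely many modes. -/
theorem IsPrimitiveH.low_modes {v R : ℝ → H} (h : IsPrimitiveH v R) (K : ℝ) :
    IsPrimitive (fun t => ‖proj K (v t)‖ ^ 2) (fun t => 2 * ⟪R t, proj K (v t)⟫_ℝ) := by
  have h1 := IsPrimitive.sum (finite_low_modes K).toFinset fun k _ => h.modeInner k
  have hs : ∀ u w : H, ∑ k ∈ (finite_low_modes K).toFinset, NSE.modeInner u w k = ⟪w, proj K u⟫_ℝ := by
    intro u w
    have h2 : HasSum (NSE.modeInner (w : L2) (proj K u : L2)) ⟪w, proj K u⟫_ℝ := hasSum_modeInner _ _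
    rw [← h2.tsum_eq, tsum_eq_sum (s := (finite_low_modes K).toFinset)]
    · refine Finset.sum_congr rfl fun k hk => ?_
      have hk' : √(sqLen k) ≤ K := by simpa using hk
      rw [modeInner_of_isMultiplier (isMultiplier_proj K u), lowMode, if_pos hk', one_mul,
        modeInner_comm]
    · intro k hk
      have hk' : ¬ √(sqLen k) ≤ K := by simpa using hk
      rw [modeInner_of_isMultiplier (isMultiplier_proj K u), lowMode, if_neg hk', zero_mul]
  simp only [← Finset.mul_sum, hs] at h1
  convert h1 using 2 with t
  rw [← real_inner_self_eq_norm_sq, inner_proj_left, proj_proj]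

end NSE

end

noncomputable section

/-! ### Pointwise differential inequalities for the intertwined system -/

namespace NSE

open scoped ComplexConjugate InnerProductSpace

/-- The right-hand side of the first equation of the mutual direct-replacement intertwinement of
`u` and `v`. -/
def mutualRHS (ν K θ : ℝ) (g u v : H) : H :=
  g - ν • stokes u - B u u + θ • proj K (B u u - B v v)

theorem hasSum_proj_sq (K : ℝ) (u : H) :
    HasSum (fun k => lowMode K k * modeInner u u k) (‖proj K u‖ ^ 2) := by
  refine (hasSum_modeInner_self (proj K u : L2)).congr_fun fun k => ?_
  rw [modeInner_of_isMultiplier (isMultiplier_proj K u), modeInner_comm (proj K u : L2),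
    modeInner_of_isMultiplier (isMultiplier_proj K u), ← mul_assoc, lowMode_mul_self]

theorem lowMode_nonneg (K : ℝ) (k : Fin 2 → ℤ) : 0 ≤ lowMode K k := by
  unfold lowMode; split_ifs <;> norm_num

theorem lowMode_le_one (K : ℝ) (k : Fin 2 → ℤ) : lowMode K k ≤ 1 := by
  unfold lowMode; split_ifs <;> norm_num

theorem sqLen_le_sq_of_sqrt_le {K : ℝ} {k : Fin 2 → ℤ} (h : √(sqLen k) ≤ K) : sqLen k ≤ K ^ 2 :=
  (Real.sqrt_le_left ((Real.sqrt_nonneg _).trans h)).1 h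

theorem norm_proj_le (K : ℝ) (u : H) : ‖proj K u‖ ≤ ‖u‖ := by
  refine le_of_sq_le_sq ?_ (norm_nonneg _)
  exact hasSum_le (fun k => mul_le_of_le_one_left (modeInner_self_nonneg _ _) (lowMode_le_one K k))
    (hasSum_proj_sq K u) (hasSum_modeInner_self (u : L2))

theorem norm_proj_stokes_le {K : ℝ} {u : H} (hu : u ∈ domStokes) :
    ‖proj K (stokes u)‖ ≤ K ^ 2 * ‖proj K u‖ := by
  refine le_of_sq_le_sq ?_ (by positivity)
  rw [mul_pow]
  refine hasSum_le (fun k => ?_) (hasSum_proj_sq K (stokes u)) ((hasSum_proj_sq K u).mul_left _)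
  rw [modeInner_of_isMultiplier (isMultiplier_stokes hu), modeInner_comm (stokes u : L2),
    modeInner_of_isMultiplier (isMultiplier_stokes hu)]
  unfold lowMode
  split_ifs with h
  · have h1 := pow_le_pow_left₀ (sqLen_nonneg k) (sqLen_le_sq_of_sqrt_le h) 2
    have := mul_le_mul_of_nonneg_right h1 (modeInner_self_nonneg (u : L2) k)
    linarith
  · simp

theorem norm_proj_sq_le_inner (K : ℝ) {u : H} (hu : u ∈ domStokes) :
    ‖proj K u‖ ^ 2 ≤ ⟪stokes u, proj K u⟫_ℝ := by
  have h : HasSum (modeInner (stokes u) (proj K u)) ⟪stokes u, proj K u⟫_ℝ := hasSum_modeInner _ _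
  refine hasSum_le (fun k => ?_) (hasSum_proj_sq K u) h
  rw [modeInner_of_isMultiplier (isMultiplier_proj K u), modeInner_comm (stokes u : L2),
    modeInner_of_isMultiplier (isMultiplier_stokes hu)]
  exact mul_le_mul_of_nonneg_left (modeInner_le_sqLen_mul u k) (lowMode_nonneg K k)

/-- The Poincaré inequality on the high modes. -/
theorem high_modes_poincare {K : ℝ} (hK : 0 ≤ K) {u : H} (hu : u ∈ domStokes) (hV : u ∈ V) :
    (1 + K ^ 2) / 2 * normV u ^ 2 - (K ^ 2) ^ 2 / 2 * ‖proj K u‖ ^ 2 ≤ ‖stokes u‖ ^ 2 := by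
  refine hasSum_le (fun k => ?_) (((hasSum_normV_sq hV).mul_left _).sub
    ((hasSum_proj_sq K u).mul_left _)) (hasSum_stokes_sq hu)
  have h0 := modeInner_self_nonneg (u : L2) k
  have h1 := mul_le_mul_of_nonneg_left (modeInner_le_sqLen_mul u k) (sqLen_nonneg k)
  have h2 := sqLen_nonneg k
  unfold lowMode
  split_ifs with h
  · have h3 := sqLen_le_sq_of_sqrt_le h
    have h4 : K ^ 2 * sqLen k ≤ (K ^ 2) ^ 2 := by nlinarith
    have h5 := mul_le_mul_of_nonneg_right h4 h0
    nlinarith [mul_nonneg (sq_nonneg (sqLen k)) h0]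
  · have h3 : K ^ 2 ≤ sqLen k := by
      have := pow_le_pow_left₀ hK (not_le.1 h).le 2
      rwa [Real.sq_sqrt h2] at this
    have h4 := mul_le_mul_of_nonneg_right (mul_le_mul_of_nonneg_right h3 h2) h0
    nlinarith

theorem normV_sq_le_add {u v : H} (hu : u ∈ V) (hv : v ∈ V) :
    normV u ^ 2 ≤ 2 * normV (u - v) ^ 2 + 2 * normV v ^ 2 := by
  have h := normV_add_le (V_sub hu hv) hv
  rw [sub_add_cancel] at h
  have h1 := pow_le_pow_left₀ (normV_nonneg u) h 2
  nlinarith [sq_nonneg (normV (u - v) - normV v)]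

theorem inner_smul_H (c : ℝ) (u v : H) : ⟪c • u, v⟫_ℝ = c * ⟪u, v⟫_ℝ :=
  real_inner_smul_left (u : L2) v c

section Estimates

variable {ν K θ₁ θ₂ δ : ℝ} {g₁ g₂ u₁ u₂ : H}

/-- The crossed weights give both coupling terms the common factor `θ₁ θ₂`, so they combine into a
pairing with the Stokes operator of the difference, to which the hypotheses on `δ` apply. As `θ₁ θ₂`
is at most either weight, the result is bounded by the weighted enstrophy itself. -/
theorem enstrophy_deriv_le {G : ℝ} (hν : 0 < ν) (hθ₁ : 0 ≤ θ₁) (hθ₂ : 0 ≤ θ₂) (hθ : θ₁ + θ₂ = 1)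
    (hu₁ : u₁ ∈ domStokes) (hu₂ : u₂ ∈ domStokes) (hV₁ : u₁ ∈ V) (hV₂ : u₂ ∈ V) (hδ0 : 0 ≤ δ)
    (hδ₁ : |⟪B u₁ u₁, proj K (stokes (u₁ - u₂))⟫_ℝ| ≤ δ * normV u₁ ^ 2)
    (hδ₂ : |⟪B u₂ u₂, proj K (stokes (u₁ - u₂))⟫_ℝ| ≤ δ * normV u₂ ^ 2)
    (hg₁ : ‖g₁‖ ^ 2 ≤ G) (hg₂ : ‖g₂‖ ^ 2 ≤ G) :
    θ₂ * (2 * ⟪mutualRHS ν K θ₁ g₁ u₁ u₂, stokes u₁⟫_ℝ) +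
      θ₁ * (2 * ⟪mutualRHS ν K θ₂ g₂ u₂ u₁, stokes u₂⟫_ℝ) ≤
    -ν * (θ₂ * ‖stokes u₁‖ ^ 2 + θ₁ * ‖stokes u₂‖ ^ 2) + G / ν +
      2 * δ * (θ₂ * normV u₁ ^ 2 + θ₁ * normV u₂ ^ 2) := by
  have key : ∀ g w : H, 2 * ⟪g, stokes w⟫_ℝ ≤ ‖g‖ ^ 2 / ν + ν * ‖stokes w‖ ^ 2 := by
    intro g w
    have h1 := real_inner_le_norm g (stokes w)
    have h2 : 2 * (‖g‖ * ‖stokes w‖) ≤ ‖g‖ ^ 2 / ν + ν * ‖stokes w‖ ^ 2 := by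
      have h3 : ‖g‖ ^ 2 / ν + ν * ‖stokes w‖ ^ 2 - 2 * (‖g‖ * ‖stokes w‖) =
          (‖g‖ - ν * ‖stokes w‖) ^ 2 / ν := by
        field_simp
        ring
      have : 0 ≤ (‖g‖ - ν * ‖stokes w‖) ^ 2 / ν := by positivity
      linarith
    linarith
  have k1 := (key g₁ u₁).trans (add_le_add_left (div_le_div_of_nonneg_right hg₁ hν.le) _)
  have k2 := (key g₂ u₂).trans (add_le_add_left (div_le_div_of_nonneg_right hg₂ hν.le) _)
  simp only [stokes_sub hu₁ hu₂, proj_sub, inner_sub_right] at hδ₁ hδ₂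
  simp only [mutualRHS, inner_add_left, inner_sub_left, inner_smul_H, real_inner_self_eq_norm_sq,
    inner_B_stokes_self hu₁ hV₁, inner_B_stokes_self hu₂ hV₂, inner_proj_left]
  have h1 := (abs_le.1 hδ₁).2
  have h2 := (abs_le.1 hδ₂).1
  have e1 : θ₁ * θ₂ * ((⟪B u₁ u₁, proj K (stokes u₁)⟫_ℝ - ⟪B u₁ u₁, proj K (stokes u₂)⟫_ℝ) -
      (⟪B u₂ u₂, proj K (stokes u₁)⟫_ℝ - ⟪B u₂ u₂, proj K (stokes u₂)⟫_ℝ)) ≤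
      θ₁ * θ₂ * (δ * normV u₁ ^ 2 + δ * normV u₂ ^ 2) :=
    mul_le_mul_of_nonneg_left (by linarith) (mul_nonneg hθ₁ hθ₂)
  have e2 : θ₁ * (θ₂ * (δ * normV u₁ ^ 2)) ≤ θ₂ * (δ * normV u₁ ^ 2) :=
    mul_le_of_le_one_left (by positivity) (by linarith)
  have e3 : θ₂ * (θ₁ * (δ * normV u₂ ^ 2)) ≤ θ₁ * (δ * normV u₂ ^ 2) :=
    mul_le_of_le_one_left (by positivity) (by linarith)
  have m1 := mul_le_mul_of_nonneg_left k1 hθ₂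
  have m2 := mul_le_mul_of_nonneg_left k2 hθ₁
  have e4 : θ₂ * (G / ν) + θ₁ * (G / ν) = G / ν := by rw [← add_mul, add_comm, hθ, one_mul]
  linarith

/-- The replacement terms add up to exactly one copy of `P_K (B(u₁,u₁) - B(u₂,u₂))`, which cancels
the nonlinearity on the low modes. What is left is linear. -/
theorem low_modes_deriv_le (hν : 0 < ν) (hθ : θ₁ + θ₂ = 1) (hu₁ : u₁ ∈ domStokes)
    (hu₂ : u₂ ∈ domStokes) :
    2 * ⟪mutualRHS ν K θ₁ g₁ u₁ u₂ - mutualRHS ν K θ₂ g₂ u₂ u₁, proj K (u₁ - u₂)⟫_ℝ ≤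
      -ν * ‖proj K (u₁ - u₂)‖ ^ 2 + ‖g₁ - g₂‖ ^ 2 / ν := by
  have hθ' : θ₂ = 1 - θ₁ := by linarith
  have h1 : ⟪mutualRHS ν K θ₁ g₁ u₁ u₂ - mutualRHS ν K θ₂ g₂ u₂ u₁, proj K (u₁ - u₂)⟫_ℝ =
      ⟪g₁ - g₂, proj K (u₁ - u₂)⟫_ℝ - ν * ⟪stokes (u₁ - u₂), proj K (u₁ - u₂)⟫_ℝ := by
    simp only [mutualRHS, inner_add_left, inner_sub_left, inner_smul_H, inner_proj_left,
      proj_proj, stokes_sub hu₁ hu₂, hθ']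
    ring
  have h2 := norm_proj_sq_le_inner K (domStokes_sub hu₁ hu₂)
  have h3 := real_inner_le_norm (g₁ - g₂) (proj K (u₁ - u₂))
  have h4 : ‖g₁ - g₂‖ ^ 2 / ν + ν * ‖proj K (u₁ - u₂)‖ ^ 2 -
      2 * (‖g₁ - g₂‖ * ‖proj K (u₁ - u₂)‖) = (‖g₁ - g₂‖ - ν * ‖proj K (u₁ - u₂)‖) ^ 2 / ν := by
    field_simp
    ring
  have h5 : 0 ≤ (‖g₁ - g₂‖ - ν * ‖proj K (u₁ - u₂)‖) ^ 2 / ν := by positivity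
  rw [h1]
  have h6 := mul_le_mul_of_nonneg_left h2 hν.le
  linarith

/-- The dissipation `2 ν |Aw|²` is spent in three parts: a quarter on `(B(w,w), A u₂)`, a quarter on
the force difference, and half on the Poincaré inequality for high modes. The low-mode coupling
gives the term in `δ`, after `‖u₁‖` is replaced by `‖w‖` and `‖u₂‖`. -/
theorem difference_deriv_le (hν : 0 < ν) (hK : 0 ≤ K) (hθ : θ₁ + θ₂ = 1)
    (hu₁ : u₁ ∈ domStokes) (hu₂ : u₂ ∈ domStokes) (hV₁ : u₁ ∈ V) (hV₂ : u₂ ∈ V) (hδ0 : 0 ≤ δ)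
    (hδ₁ : |⟪B u₁ u₁, proj K (stokes (u₁ - u₂))⟫_ℝ| ≤ δ * normV u₁ ^ 2)
    (hδ₂ : |⟪B u₂ u₂, proj K (stokes (u₁ - u₂))⟫_ℝ| ≤ δ * normV u₂ ^ 2) :
    2 * ⟪mutualRHS ν K θ₁ g₁ u₁ u₂ - mutualRHS ν K θ₂ g₂ u₂ u₁, stokes (u₁ - u₂)⟫_ℝ ≤
      -(ν / 2) * (1 + K ^ 2) * normV (u₁ - u₂) ^ 2 + ν / 2 * (K ^ 2) ^ 2 * ‖proj K (u₁ - u₂)‖ ^ 2 +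
      (4 * (2 * embConst) ^ 2 / ν ^ 2) * (ν / 2) * ‖stokes u₂‖ ^ 2 * normV (u₁ - u₂) ^ 2 +
      2 / ν * ‖g₁ - g₂‖ ^ 2 + δ * (4 * normV (u₁ - u₂) ^ 2 + 6 * normV u₂ ^ 2) := by
  have hθ' : θ₂ = 1 - θ₁ := by linarith
  have hw := domStokes_sub hu₁ hu₂
  have hwV := V_sub hV₁ hV₂
  have h1 : ⟪mutualRHS ν K θ₁ g₁ u₁ u₂ - mutualRHS ν K θ₂ g₂ u₂ u₁, stokes (u₁ - u₂)⟫_ℝ =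
      ⟪g₁ - g₂, stokes (u₁ - u₂)⟫_ℝ - ν * ‖stokes (u₁ - u₂)‖ ^ 2 -
      ⟪B u₁ u₁ - B u₂ u₂, stokes (u₁ - u₂)⟫_ℝ +
      (⟪B u₁ u₁, proj K (stokes (u₁ - u₂))⟫_ℝ - ⟪B u₂ u₂, proj K (stokes (u₁ - u₂))⟫_ℝ) := by
    rw [← real_inner_self_eq_norm_sq]
    nth_rw 3 [stokes_sub hu₁ hu₂]
    simp only [mutualRHS, inner_add_left, inner_sub_left, inner_smul_H, inner_proj_left,
      hθ']
    ring
  rw [h1, inner_B_sub_stokes_sub hu₁ hu₂ hV₁ hV₂]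
  set w := u₁ - u₂
  have hN : ⟪B w w, stokes u₂⟫_ℝ ≤ 2 * embConst * (‖stokes w‖ * normV w) * ‖stokes u₂‖ :=
    (real_inner_le_norm _ _).trans (mul_le_mul_of_nonneg_right (norm_B_le hw w) (norm_nonneg _))
  have hN2 : 2 * (2 * embConst * (‖stokes w‖ * normV w) * ‖stokes u₂‖) ≤ ν / 2 * ‖stokes w‖ ^ 2 +
      (4 * (2 * embConst) ^ 2 / ν ^ 2) * (ν / 2) * ‖stokes u₂‖ ^ 2 * normV w ^ 2 := by
    have e : ν / 2 * ‖stokes w‖ ^ 2 +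
        (4 * (2 * embConst) ^ 2 / ν ^ 2) * (ν / 2) * ‖stokes u₂‖ ^ 2 * normV w ^ 2 -
        2 * (2 * embConst * (‖stokes w‖ * normV w) * ‖stokes u₂‖) =
        (ν * ‖stokes w‖ - 4 * embConst * normV w * ‖stokes u₂‖) ^ 2 / (2 * ν) := by
      field_simp
      ring
    have : 0 ≤ (ν * ‖stokes w‖ - 4 * embConst * normV w * ‖stokes u₂‖) ^ 2 / (2 * ν) := by positivity
    linarith
  have hG := real_inner_le_norm (g₁ - g₂) (stokes w)
  have hG2 : 2 * (‖g₁ - g₂‖ * ‖stokes w‖) ≤ ν / 2 * ‖stokes w‖ ^ 2 + 2 / ν * ‖g₁ - g₂‖ ^ 2 := by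
    have e : ν / 2 * ‖stokes w‖ ^ 2 + 2 / ν * ‖g₁ - g₂‖ ^ 2 - 2 * (‖g₁ - g₂‖ * ‖stokes w‖) =
        (ν * ‖stokes w‖ - 2 * ‖g₁ - g₂‖) ^ 2 / (2 * ν) := by
      field_simp
      ring
    have : 0 ≤ (ν * ‖stokes w‖ - 2 * ‖g₁ - g₂‖) ^ 2 / (2 * ν) := by positivity
    linarith
  have hP := mul_le_mul_of_nonneg_left (high_modes_poincare hK hw hwV) hν.le
  have hA := mul_le_mul_of_nonneg_left (normV_sq_le_add hV₁ hV₂) hδ0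
  have h3 := (abs_le.1 hδ₁).2
  have h4 := (abs_le.1 hδ₂).1
  linarith

end Estimates

end NSE

end

noncomputable section

/-! ### From the solution to the asymptotic bound -/

namespace NSE

open scoped ComplexConjugate InnerProductSpace

/-- `v ∈ C([0,T]; V) ∩ L²(0,T; D(A))` for all `T > 0`. -/
structure IsStrongPath (v : ℝ → H) : Prop where
  mem_V : ∀ t, 0 ≤ t → v t ∈ V
  continuous_V : ∀ t, 0 ≤ t → Tendsto (fun s => normV (v s - v t)) (𝓝[Set.Ici 0] t) (𝓝 0)
  mem_domStokes : ∀ᵐ t ∂volume.restrict (Set.Ioi (0 : ℝ)), v t ∈ domStokes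
  memLp_stokes : ∀ T, 0 < T → MemLp (fun t => stokes (v t)) 2 (volume.restrict (Set.Ioo 0 T))

namespace IsStrongPath

variable {v w : ℝ → H}

theorem continuousOn_normV (hv : IsStrongPath v) : ContinuousOn (fun t => normV (v t)) (Set.Ici 0) := by
  intro t ht
  refine tendsto_iff_dist_tendsto_zero.2 (squeeze_zero' (Eventually.of_forall fun s => dist_nonneg) ?_
    (hv.continuous_V t ht))
  filter_upwards [self_mem_nhdsWithin] with s hs
  have h1 := hv.mem_V t ht
  have h2 := hv.mem_V s hs
  have h3 := normV_add_le (V_sub h2 h1) h1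
  have h4 := normV_add_le (V_sub h1 h2) h2
  have h5 : normV (v t - v s) = normV (v s - v t) := by
    unfold normV
    congr 1
    refine Finset.sum_congr rfl fun j _ => ?_
    rw [partialDeriv_sub h1 h2, partialDeriv_sub h2 h1, norm_sub_rev]
  rw [sub_add_cancel] at h3 h4
  rw [Real.dist_eq, abs_le]
  constructor <;> linarith

theorem exists_bound (hv : IsStrongPath v) (T : ℝ) : ∃ Y, ∀ t ∈ Set.Icc 0 T, normV (v t) ≤ Y := by
  obtain ⟨Y, hY⟩ := isCompact_Icc.exists_bound_of_continuousOn
    (hv.continuousOn_normV.mono fun t (ht : t ∈ Set.Icc 0 T) => ht.1)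
  exact ⟨Y, fun t ht => (le_abs_self _).trans (hY t ht)⟩

theorem memLp_stokes_sub (hv : IsStrongPath v) (hw : IsStrongPath w) {T : ℝ} (hT : 0 < T) :
    MemLp (fun t => stokes (v t - w t)) 2 (volume.restrict (Set.Ioo 0 T)) := by
  refine (memLp_congr_ae ?_).1 ((hv.memLp_stokes T hT).sub (hw.memLp_stokes T hT))
  filter_upwards [ae_restrict_of_ae_restrict_of_subset Set.Ioo_subset_Ioi_self hv.mem_domStokes,
    ae_restrict_of_ae_restrict_of_subset Set.Ioo_subset_Ioi_self hw.mem_domStokes] with t h1 h2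
  exact (stokes_sub h1 h2).symm

end IsStrongPath

theorem norm_mutualRHS_le {ν K θ G Y Y' : ℝ} {g u w : H} (hu : u ∈ domStokes) (hw : w ∈ domStokes)
    (hg : ‖g‖ ^ 2 ≤ G) (hY : normV u ≤ Y) (hY' : normV w ≤ Y') :
    ‖mutualRHS ν K θ g u w‖ ≤ √G + (|ν| + (1 + |θ|) * (2 * embConst * Y)) * ‖stokes u‖ +
      |θ| * (2 * embConst * Y') * ‖stokes w‖ := by
  have hB : ∀ {x : H} {y : ℝ}, x ∈ domStokes → normV x ≤ y →
      ‖B x x‖ ≤ 2 * embConst * y * ‖stokes x‖ := by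
    intro x y hx hy
    refine (norm_B_le hx x).trans ?_
    rw [mul_assoc _ y, mul_comm y]
    exact mul_le_mul_of_nonneg_left (mul_le_mul_of_nonneg_left hy (norm_nonneg _))
      (mul_nonneg zero_le_two embConst_nonneg)
  have hg' : ‖g‖ ≤ √G := Real.le_sqrt_of_sq_le hg
  have hP : ‖θ • proj K (B u u - B w w)‖ ≤ |θ| * (‖B u u‖ + ‖B w w‖) := by
    rw [norm_smul, Real.norm_eq_abs]
    exact mul_le_mul_of_nonneg_left ((norm_proj_le _ _).trans (norm_sub_le _ _)) (abs_nonneg _)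
  have hS : ‖ν • stokes u‖ = |ν| * ‖stokes u‖ := by rw [norm_smul, Real.norm_eq_abs]
  have hm := mul_le_mul_of_nonneg_left (add_le_add (hB hu hY) (hB hw hY')) (abs_nonneg θ)
  have h1 := norm_add_le (g - ν • stokes u - B u u) (θ • proj K (B u u - B w w))
  have h2 := norm_sub_le (g - ν • stokes u) (B u u)
  have h3 := norm_sub_le g (ν • stokes u)
  have h4 := hB hu hY
  rw [mutualRHS]
  linarith

theorem memLp_affine_norm {T : ℝ} (a b c : ℝ) {f h : ℝ → H}
    (hf : MemLp f 2 (volume.restrict (Set.Ioo 0 T))) (hh : MemLp h 2 (volume.restrict (Set.Ioo 0 T))) :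
    MemLp (fun t => a + b * ‖f t‖ + c * ‖h t‖) 2 (volume.restrict (Set.Ioo 0 T)) := by
  have h1 : MemLp (fun _ : ℝ => a) 2 (volume.restrict (Set.Ioo 0 T)) := memLp_const a
  exact (h1.add (hf.norm.const_mul b)).add (hh.norm.const_mul c)

/-- The `V` norms are bounded on `[0, T]`, so the nonlinear terms are at most linear in the Stokes
terms, which are square-integrable in time. The energy identity needs this square integrability. -/
theorem memLp_mutualRHS {ν K θ G : ℝ} {g v w : ℝ → H} (hv : IsStrongPath v) (hw : IsStrongPath w)
    (hi : ∀ T, 0 < T → IntervalIntegrable (fun t => mutualRHS ν K θ (g t) (v t) (w t)) volume 0 T)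
    (hg : ∀ᵐ t ∂volume.restrict (Set.Ioi (0 : ℝ)), ‖g t‖ ^ 2 ≤ G) {T : ℝ} (hT : 0 < T) :
    MemLp (fun t => mutualRHS ν K θ (g t) (v t) (w t)) 2 (volume.restrict (Set.Ioo 0 T)) := by
  obtain ⟨Y, hY⟩ := hv.exists_bound T
  obtain ⟨Y', hY'⟩ := hw.exists_bound T
  have hbm : MemLp (fun t => √G + (|ν| + (1 + |θ|) * (2 * embConst * Y)) * ‖stokes (v t)‖ +
      |θ| * (2 * embConst * Y') * ‖stokes (w t)‖) 2 (volume.restrict (Set.Ioo 0 T)) :=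
    memLp_affine_norm _ _ _ (hv.memLp_stokes T hT) (hw.memLp_stokes T hT)
  have hm := ((intervalIntegrable_iff_integrableOn_Ioc_of_le hT.le).1 (hi T hT)).aestronglyMeasurable
  rw [Measure.restrict_congr_set Ioo_ae_eq_Ioc.symm] at hm
  refine hbm.of_le hm ?_
  filter_upwards [ae_restrict_of_ae_restrict_of_subset Set.Ioo_subset_Ioi_self hv.mem_domStokes,
    ae_restrict_of_ae_restrict_of_subset Set.Ioo_subset_Ioi_self hw.mem_domStokes,
    ae_restrict_of_ae_restrict_of_subset Set.Ioo_subset_Ioi_self hg,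
    ae_restrict_mem measurableSet_Ioo] with t h1 h2 h3 ht
  exact (norm_mutualRHS_le h1 h2 h3 (hY t ⟨ht.1.le, ht.2.le⟩) (hY' t ⟨ht.1.le, ht.2.le⟩)).trans
    (le_abs_self _)

theorem eventually_normV_sq_le {ν K θ₁ θ₂ G : ℝ} {g₁ g₂ v₁ v₂ : ℝ → H} (hν : 0 < ν) (hK : 0 < K)
    (hθ₁ : 1 / 2 ≤ θ₁) (hθ₂ : 0 ≤ θ₂) (hθ : θ₁ + θ₂ = 1)
    (hv₁ : IsStrongPath v₁) (hv₂ : IsStrongPath v₂)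
    (h₁ : IsPrimitiveH v₁ fun t => mutualRHS ν K θ₁ (g₁ t) (v₁ t) (v₂ t))
    (h₂ : IsPrimitiveH v₂ fun t => mutualRHS ν K θ₂ (g₂ t) (v₂ t) (v₁ t))
    (hg₁ : ∀ᵐ t ∂volume.restrict (Set.Ioi (0 : ℝ)), ‖g₁ t‖ ^ 2 ≤ G)
    (hg₂ : ∀ᵐ t ∂volume.restrict (Set.Ioi (0 : ℝ)), ‖g₂ t‖ ^ 2 ≤ G) (hG : 0 ≤ G)
    (hsync : ∀ ε, 0 < ε → ∀ᶠ T in atTop, ∀ᵐ t ∂volume.restrict (Set.Ioi (T : ℝ)),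
      ‖g₁ t - g₂ t‖ ^ 2 ≤ ε)
    (hKG : 8 * (2 * embConst) ^ 2 * G ≤ ν ^ 4 * K ^ 2) {ε : ℝ} (hε : 0 < ε) :
    ∀ᶠ t in atTop, normV (v₁ t) ^ 2 + normV (v₂ t) ^ 2 ≤ 6 * (G / ν ^ 2) + ε := by
  have hR₁ := fun T (hT : 0 < T) => memLp_mutualRHS hv₁ hv₂ h₁.1 hg₁ hT
  have hR₂ := fun T (hT : 0 < T) => memLp_mutualRHS hv₂ hv₁ h₂.1 hg₂ hT
  have hE₁ := h₁.energy (fun t ht => hasSum_normV_sq (hv₁.mem_V t ht))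
    (hv₁.mem_domStokes.mono fun t ht => isMultiplier_stokes ht) hR₁ hv₁.memLp_stokes
  have hE₂ := h₂.energy (fun t ht => hasSum_normV_sq (hv₂.mem_V t ht))
    (hv₂.mem_domStokes.mono fun t ht => isMultiplier_stokes ht) hR₂ hv₂.memLp_stokes
  have hw := h₁.sub h₂
  have hEw := hw.energy (fun t ht => hasSum_normV_sq (V_sub (hv₁.mem_V t ht) (hv₂.mem_V t ht)))
    ((hv₁.mem_domStokes.and hv₂.mem_domStokes).mono fun t ht =>
      isMultiplier_stokes (domStokes_sub ht.1 ht.2))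
    (fun T hT => (hR₁ T hT).sub (hR₂ T hT)) (fun T hT => hv₁.memLp_stokes_sub hv₂ hT)
  have hEz := hw.low_modes K
  have hX := (hE₁.const_mul θ₂).add (hE₂.const_mul θ₁)
  obtain ⟨C, hC, hCb⟩ := exists_inner_B_low_modes_bound K
  have hθ₁0 : 0 ≤ θ₁ := by linarith
  have hV : ∀ᵐ t ∂volume.restrict (Set.Ioi (0 : ℝ)), v₁ t ∈ V ∧ v₂ t ∈ V := by
    filter_upwards [ae_restrict_mem measurableSet_Ioi] with t ht
    exact ⟨hv₁.mem_V t (le_of_lt ht), hv₂.mem_V t (le_of_lt ht)⟩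
  have hδ : ∀ u w : H, u ∈ domStokes → u ∈ V → w ∈ domStokes →
      |⟪B u u, proj K (stokes w)⟫_ℝ| ≤ C * K ^ 2 * √(‖proj K w‖ ^ 2) * normV u ^ 2 := by
    intro u w hu huV hw
    refine (hCb u (stokes w) hu huV).trans ?_
    rw [Real.sqrt_sq (norm_nonneg _), mul_assoc C (K ^ 2)]
    exact mul_le_mul_of_nonneg_right (mul_le_mul_of_nonneg_left (norm_proj_stokes_le hw) hC)
      (sq_nonneg _)
  have hmain := decay_of_differential_inequalities (ν := ν) (Γ := G / ν) (D := C * K ^ 2)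
    (c := 4 * (2 * embConst) ^ 2 / ν ^ 2) (κ := K ^ 2) (Y₂ := fun t => normV (v₂ t) ^ 2)
    (Q := fun t => ‖stokes (v₂ t)‖ ^ 2) (d := fun t => ‖g₁ t - g₂ t‖ ^ 2)
    hν (by positivity) (by positivity) (by positivity) ?_ hX hEw hEz ?_ (fun t _ => sq_nonneg _)
    (fun t _ => sq_nonneg _) ?_ hsync ?_ ?_ ?_ ?_
  · obtain ⟨hy, hXlim⟩ := hmain
    filter_upwards [hy.eventually (Iic_mem_nhds (show (0 : ℝ) < ε / 8 by positivity)),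
      hXlim (ε / 8) (by positivity), eventually_ge_atTop 0] with t h1 h2 ht
    have h3 := normV_sq_le_add (hv₁.mem_V t ht) (hv₂.mem_V t ht)
    have h4 : 1 / 2 * normV (v₂ t) ^ 2 ≤ θ₁ * normV (v₂ t) ^ 2 :=
      mul_le_mul_of_nonneg_right hθ₁ (sq_nonneg _)
    have h5 : 0 ≤ θ₂ * normV (v₁ t) ^ 2 := by positivity
    have h6 : G / ν / ν = G / ν ^ 2 := by rw [div_div, sq]
    have h7 : normV (v₁ t - v₂ t) ^ 2 ≤ ε / 8 := h1
    rw [h6] at h2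
    linarith
  -- The smallness condition of the decay argument is `hKG` divided by `2 ν ^ 3`.
  · have : ν / 2 * K ^ 2 - 4 * (2 * embConst) ^ 2 / ν ^ 2 * (G / ν) =
        (ν ^ 4 * K ^ 2 - 8 * (2 * embConst) ^ 2 * G) / (2 * ν ^ 3) := by
      field_simp
      ring
    have h0 : 0 ≤ (ν ^ 4 * K ^ 2 - 8 * (2 * embConst) ^ 2 * G) / (2 * ν ^ 3) :=
      div_nonneg (by linarith) (by positivity)
    linarith
  · intro t _
    positivity
  · intro t _
    have h4 : 1 / 2 * normV (v₂ t) ^ 2 ≤ θ₁ * normV (v₂ t) ^ 2 :=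
      mul_le_mul_of_nonneg_right hθ₁ (sq_nonneg _)
    have h5 : 0 ≤ θ₂ * normV (v₁ t) ^ 2 := by positivity
    linarith
  · filter_upwards [hv₁.mem_domStokes, hv₂.mem_domStokes, hV, hg₁, hg₂] with t d₁ d₂ hVt hg₁t hg₂t
    have hd := domStokes_sub d₁ d₂
    have h := enstrophy_deriv_le (K := K) hν hθ₁0 hθ₂ hθ d₁ d₂ hVt.1 hVt.2 (by positivity)
      (hδ _ _ d₁ hVt.1 hd) (hδ _ _ d₂ hVt.2 hd) hg₁t hg₂t
    refine h.trans ?_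
    -- Here the dissipation is kept as `|A v₂|²`, to pay for the growth of the difference; in the
    -- next inequality the Poincaré inequality turns it into damping of `X`.
    have h4 : 1 / 2 * ‖stokes (v₂ t)‖ ^ 2 ≤ θ₁ * ‖stokes (v₂ t)‖ ^ 2 :=
      mul_le_mul_of_nonneg_right hθ₁ (sq_nonneg _)
    have h5 : 0 ≤ θ₂ * ‖stokes (v₁ t)‖ ^ 2 := by positivity
    have h6 := mul_le_mul_of_nonneg_left (add_le_add h5 h4) hν.le
    linarith
  · filter_upwards [hv₁.mem_domStokes, hv₂.mem_domStokes, hV, hg₁, hg₂] with t d₁ d₂ hVt hg₁t hg₂t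
    have hd := domStokes_sub d₁ d₂
    have h := enstrophy_deriv_le (K := K) hν hθ₁0 hθ₂ hθ d₁ d₂ hVt.1 hVt.2 (by positivity)
      (hδ _ _ d₁ hVt.1 hd) (hδ _ _ d₂ hVt.2 hd) hg₁t hg₂t
    refine h.trans ?_
    have h4 := mul_le_mul_of_nonneg_left
      (pow_le_pow_left₀ (normV_nonneg _) (normV_le_norm_stokes hVt.1 d₁) 2) hθ₂
    have h5 := mul_le_mul_of_nonneg_left
      (pow_le_pow_left₀ (normV_nonneg _) (normV_le_norm_stokes hVt.2 d₂) 2) hθ₁0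
    have h6 := mul_le_mul_of_nonneg_left (add_le_add h4 h5) hν.le
    linarith
  · filter_upwards [hv₁.mem_domStokes, hv₂.mem_domStokes, hV] with t d₁ d₂ hVt
    have hd := domStokes_sub d₁ d₂
    exact difference_deriv_le (K := K) hν hK.le hθ d₁ d₂ hVt.1 hVt.2 (by positivity)
      (hδ _ _ d₁ hVt.1 hd) (hδ _ _ d₂ hVt.2 hd)
  · filter_upwards [hv₁.mem_domStokes, hv₂.mem_domStokes] with t d₁ d₂
    exact low_modes_deriv_le hν hθ d₁ d₂

theorem IsSynchronousPair.eventually_ae {g₁ g₂ : ℝ → H} (h : IsSynchronousPair g₁ g₂) {ε : ℝ}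
    (hε : 0 < ε) : ∀ᶠ T in atTop, ∀ᵐ t ∂volume.restrict (Set.Ioi (T : ℝ)), ‖g₁ t - g₂ t‖ ^ 2 ≤ ε := by
  have h1 := h.eventually (Iic_mem_nhds (Real.sqrt_pos.2 hε))
  obtain ⟨s, hs, t, ht, H⟩ := eventually_inf.1 h1
  obtain ⟨T₀, hT₀⟩ := mem_atTop_sets.1 hs
  filter_upwards [eventually_ge_atTop T₀] with T hT
  refine (ae_restrict_iff' measurableSet_Ioi).2 ?_
  filter_upwards [ht] with r hr hrT
  have h2 : ‖g₁ r - g₂ r‖ ≤ √ε := H r ⟨hT₀ r (hT.trans (le_of_lt hrT)), hr⟩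
  calc ‖g₁ r - g₂ r‖ ^ 2 ≤ √ε ^ 2 := pow_le_pow_left₀ (norm_nonneg _) h2 2
    _ = ε := Real.sq_sqrt hε.le

theorem IsBoundedForce.ae_norm_sq_le {ν : ℝ} {g : Fin 2 → ℝ → H} (hν : 0 < ν) (j : Fin 2)
    (h : IsBoundedForce (g j)) :
    ∀ᵐ t ∂volume.restrict (Set.Ioi (0 : ℝ)), ‖g j t‖ ^ 2 ≤ ν ^ 4 * grashof ν g ^ 2 := by
  have h1 : ν ^ 4 * grashof₁ ν (g j) ^ 2 ≤ ν ^ 4 * grashof ν g ^ 2 := by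
    refine mul_le_mul_of_nonneg_left ?_ (by positivity)
    rw [grashof, Real.sq_sqrt (by positivity)]
    exact Finset.single_le_sum (f := fun j => grashof₁ ν (g j) ^ 2) (fun i _ => sq_nonneg _)
      (Finset.mem_univ j)
  have h2 : ν ^ 4 * grashof₁ ν (g j) ^ 2 =
      (eLpNorm (g j) ⊤ (volume.restrict (Set.Ioi (0 : ℝ)))).toReal ^ 2 := by
    rw [grashof₁]
    field_simp
  rw [h2] at h1
  have h3 := h.eLpNorm_ne_top
  filter_upwards [ae_le_eLpNormEssSup (f := g j) (μ := volume.restrict (Set.Ioi (0 : ℝ)))] with t ht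
  refine le_trans (pow_le_pow_left₀ (norm_nonneg _) ?_ 2) h1
  rw [← eLpNorm_exponent_top] at ht
  simpa using ENNReal.toReal_mono h3 ht

theorem IsGlobalSolution.isStrongPath {ν : ℝ} {F : H → H} {M : Matrix (Fin 2) (Fin 2) ℝ}
    {g v : Fin 2 → ℝ → H} (h : IsGlobalSolution ν F M g v) (i : Fin 2) : IsStrongPath (v i) :=
  ⟨h.mem_V i, h.continuous_V i, h.mem_domStokes i, h.memLp_stokes i⟩

theorem IsGlobalSolution.isPrimitiveH {ν K θ : ℝ} {M : Matrix (Fin 2) (Fin 2) ℝ}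
    {g v : Fin 2 → ℝ → H} (h : IsGlobalSolution ν (directReplacement K) M g v) (i j : Fin 2)
    (hsum : ∀ f : Fin 2 → H, ∑ l, M i l • f l = θ • (f i - f j)) :
    IsPrimitiveH (v i) fun t => mutualRHS ν K θ (g i t) (v i t) (v j t) := by
  have e : intertwinedRHS ν (directReplacement K) M g v i =
      fun t => mutualRHS ν K θ (g i t) (v i t) (v j t) := by
    funext t
    rw [intertwinedRHS, mutualRHS, proj_sub, hsum fun l => directReplacement K (v l t)]
    rfl
  rw [← e]
  exact ⟨h.integrable_rhs i, h.equation i⟩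

end NSE

end

theorem mainTheorem5 :
    ∃ C₀ : ℝ, 0 < C₀ ∧ ∃ C₁ : ℝ, 0 < C₁ ∧
      ∀ (ν K : ℝ) (M : Matrix (Fin 2) (Fin 2) ℝ) (g v : Fin 2 → ℝ → NSE.H),
        0 < ν → 0 < K → M ∈ NSE.mutualMatrices →
        (∀ j, NSE.IsBoundedForce (g j)) →
        NSE.IsSynchronousPair (g 0) (g 1) →
        NSE.IsGlobalSolution ν (NSE.directReplacement K) M g v →
        C₀ * √(Real.log (Real.exp 1 + K)) * NSE.grashof ν g ≤ K →
        limsup (fun t : ℝ => ((NSE.normVPair (fun i => v i t) : ℝ) : EReal)) atTop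
          ≤ ((C₁ * ν * NSE.grashof ν g : ℝ) : EReal) := by
  -- The six comes from `8 · 2² = 32 ≤ 6²`, and adding one keeps the constant positive. The three
  -- comes from `√6 ≤ 3`.
  have hemb := NSE.embConst_nonneg
  refine ⟨6 * NSE.embConst + 1, by positivity, 3, by norm_num, ?_⟩
  rintro ν K M g v hν hK ⟨θ₁, θ₂, hθ, hθ₁, hθ₂, rfl⟩ hg hsync hsol hKg
  have hgr : 0 ≤ NSE.grashof ν g := Real.sqrt_nonneg _
  set γ := NSE.grashof ν g with hγ
  -- The logarithmic factor enters only as a number at least one: the estimate of `B` in terms of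
  -- `|Aw| ‖w‖` costs no logarithm.
  have hlog : 1 ≤ √(Real.log (Real.exp 1 + K)) := by
    rw [Real.one_le_sqrt]
    calc (1 : ℝ) = Real.log (Real.exp 1) := (Real.log_exp 1).symm
      _ ≤ _ := Real.log_le_log (Real.exp_pos 1) (by linarith)
  have hKγ : 6 * NSE.embConst * γ ≤ K := by
    refine le_trans ?_ hKg
    refine mul_le_mul_of_nonneg_right ?_ hgr
    nlinarith
  have hKG : 8 * (2 * NSE.embConst) ^ 2 * (ν ^ 4 * γ ^ 2) ≤ ν ^ 4 * K ^ 2 := by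
    have h1 : (6 * NSE.embConst * γ) ^ 2 ≤ K ^ 2 := pow_le_pow_left₀ (by positivity) hKγ 2
    have h2 := mul_le_mul_of_nonneg_left h1 (show 0 ≤ ν ^ 4 by positivity)
    have h3 : 0 ≤ ν ^ 4 * (NSE.embConst * γ) ^ 2 := by positivity
    linarith
  have hb := fun j => (hg j).ae_norm_sq_le hν j
  have hp₀ := hsol.isPrimitiveH (θ := θ₁) 0 1 fun f => by
    simp only [Fin.sum_univ_two, Matrix.of_apply, Matrix.cons_val', Matrix.cons_val_zero,
      Matrix.cons_val_one]
    module
  have hp₁ := hsol.isPrimitiveH (θ := θ₂) 1 0 fun f => by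
    simp only [Fin.sum_univ_two, Matrix.of_apply, Matrix.cons_val', Matrix.cons_val_zero,
      Matrix.cons_val_one]
    module
  have key : ∀ ε, 0 < ε → ∀ᶠ t in atTop,
      NSE.normV (v 0 t) ^ 2 + NSE.normV (v 1 t) ^ 2 ≤ 6 * (ν ^ 4 * γ ^ 2 / ν ^ 2) + ε := by
    intro ε hε
    -- The system is symmetric in the two fields, so the one with the larger weight in `X` may be
    -- taken as the second.
    rcases le_total (1 / 2) θ₁ with h | h
    · exact NSE.eventually_normV_sq_le hν hK h hθ₂ hθ (hsol.isStrongPath 0) (hsol.isStrongPath 1)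
        hp₀ hp₁ (hb 0) (hb 1) (by positivity) (fun ε hε => hsync.eventually_ae hε) hKG hε
    · have h' := NSE.eventually_normV_sq_le hν hK (by linarith : 1 / 2 ≤ θ₂) hθ₁ (by linarith)
        (hsol.isStrongPath 1) (hsol.isStrongPath 0) hp₁ hp₀ (hb 1) (hb 0) (by positivity)
        (fun ε hε => by simpa only [norm_sub_rev] using hsync.eventually_ae hε) hKG hε
      filter_upwards [h'] with t ht
      rwa [add_comm]
  refine EReal.le_of_forall_lt_iff_le.1 fun r hr => ?_
  have hr' : 3 * ν * γ < r := EReal.coe_lt_coe_iff.1 hr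
  refine limsup_le_of_le (by isBoundedDefault) ?_
  -- With `s = r - 3 ν γ` the choice `ε = s²` suffices, as `6 (ν γ)² + s² ≤ (3 ν γ + s)²`.
  filter_upwards [key ((r - 3 * ν * γ) ^ 2) (pow_pos (by linarith) 2)] with t ht
  refine EReal.coe_le_coe_iff.2 ?_
  have h0 : 0 ≤ ν * γ := by positivity
  rw [NSE.normVPair]
  refine Real.sqrt_le_iff.2 ⟨by linarith, ?_⟩
  rw [Fin.sum_univ_two]
  refine ht.trans ?_
  have e : ν ^ 4 * γ ^ 2 / ν ^ 2 = (ν * γ) ^ 2 := by field_simp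
  rw [e]
  nlinarith [mul_nonneg h0 (show 0 ≤ r - 3 * ν * γ by linarith), sq_nonneg (ν * γ)]
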